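/- Let $(R,\mathfrak m)$ be a Cohen–Macaulay local ring with $\dim R=1$, and write $\ell_R(\cdot)$ for the length of an $R$-module. A canonical ideal of $R$ is an ideal $I\neq R$ that is isomorphic, as an $R$-module, to the canonical module $\mathrm K_R$ of $R$. Let $I$ be a canonical ideal of $R$ that contains a parameter ideal $Q=(a)$ of $R$ as a reduction, that is, $I^{n+1}=QI^n$ for some $n\ge 0$. In the total ring of fractions $\mathrm Q(R)$ of $R$ put $$K=\frac{I}{a}=\left\{\frac{x}{a}\;\middle|\; x\in I\right\},\qquad S=R[K],\qquad \mathfrak c=R:S=\{x\in \mathrm Q(R)\mid xS\subseteq R\}.$$ Let $\mathrm e_0(I),\mathrm e_1(I)$ be the Hilbert coefficients of $I$, that is, the integers with $\ell_R(R/I^{n+1})=\mathrm e_0(I)\binom{n+1}{1}-\mathrm e_1(I)$ for all $n\gg 0$, and let $\mathrm r_Q(I)=\min\{n\ge 0\mid I^{n+1}=QI^n\}$ be the reduction number. Let $\mathcal T=R[Qt]$ and $\mathcal R=R[It]$ be the Rees algebras, let $\mathcal S_Q(I)=I\mathcal R/I\mathcal T$ be the Sally module, and let $\operatorname{rank}\mathcal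 S_Q(I)=\ell_{\mathcal T_{\mathfrak p}}([\mathcal S_Q(I)]_{\mathfrak p})$, where $\mathfrak p=\mathfrak m\mathcal T$ (a prime ideal of $\mathcal T$). Then the following hold. (1) The lengths $\ell_R(S/K)$ and $\ell_R(R/I)$ are finite, and $\ell_R(S/K)=\mathrm e_1(I)-[\mathrm e_0(I)-\ell_R(R/I)]$. Moreover $\operatorname{rank}\mathcal S_Q(I)=\ell_R(S/K)=\ell_R(R/\mathfrak c)$. (2) The numbers $\mathrm r_Q(I)$, $\ell_R(S/K)$ and $\ell_R(K/R)$ (the last is finite as well) are independent of the choice of the canonical ideal $I$ and of its reduction $Q=(a)$. (3) The subring $S=R[K]$ of $\mathrm Q(R)$ is independent of the choice of $I$ and $Q=(a)$. -/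

import Mathlib

universe u v

noncomputable section

open CategoryTheory Polynomial

/-- The local ring `R` is Cohen–Macaulay: it is Noetherian and its maximal ideal contains a
regular sequence whose length is the Krull dimension of `R`. -/
structure IsCohenMacaulayLocalRing (R : Type u) [CommRing R] [IsLocalRing R] : Prop where
  noetherian : IsNoetherianRing R
  exists_regular : ∃ rs : List R, (∀ r ∈ rs, r ∈ IsLocalRing.maximalIdeal R) ∧
    RingTheory.Sequence.IsRegular R rs ∧ (rs.length : WithBot ℕ∞) = ringKrullDim R

/-- `M` is a canonical module of the (Cohen–Macaulay) local ring `R` with residue field `k` and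
dimension `d`: it is finitely generated, and `Ext_R^i(k, M)` is one-dimensional over `k` for
`i = d` and zero for every `i ≠ d`. In other words, `M` is maximal Cohen–Macaulay, of type one
and of finite injective dimension. -/
structure IsCanonicalModule (R : Type u) [CommRing R] [IsLocalRing R]
    (M : Type u) [AddCommGroup M] [Module R M] : Prop where
  finite : Module.Finite R M
  length_ext_eq_one : ∀ i : ℕ, (i : WithBot ℕ∞) = ringKrullDim R →
    Module.length R (Abelian.Ext.{u} (ModuleCat.of R (IsLocalRing.ResidueField R))
      (ModuleCat.of R M) i) = 1
  length_ext_eq_zero : ∀ i : ℕ, (i : WithBot ℕ∞) ≠ ringKrullDim R →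
    Module.length R (Abelian.Ext.{u} (ModuleCat.of R (IsLocalRing.ResidueField R))
      (ModuleCat.of R M) i) = 0

/-- The quotient module `P / N` for submodules `N ⊆ P` of a module. -/
def SubmoduleQuotient {T : Type u} {M : Type v} [CommRing T] [AddCommGroup M] [Module T M]
    (N P : Submodule T M) : Type v :=
  P ⧸ N.submoduleOf P

instance SubmoduleQuotient.instAddCommGroup {T : Type u} {M : Type v} [CommRing T]
    [AddCommGroup M] [Module T M] (N P : Submodule T M) : AddCommGroup (SubmoduleQuotient N P) :=
  inferInstanceAs (AddCommGroup (P ⧸ N.submoduleOf P))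

instance SubmoduleQuotient.instModule {T : Type u} {M : Type v} [CommRing T]
    [AddCommGroup M] [Module T M] (N P : Submodule T M) : Module T (SubmoduleQuotient N P) :=
  inferInstanceAs (Module T (P ⧸ N.submoduleOf P))

variable {R : Type u} [CommRing R]

/-- A canonical ideal: a proper ideal which, as an `R`-module, is a canonical module of `R`. -/
def IsCanonicalIdeal [IsLocalRing R] (I : Ideal R) : Prop :=
  I ≠ ⊤ ∧ IsCanonicalModule R I

/-- A parameter ideal of a one-dimensional local ring: a principal ideal `(a)` that is primary to
the maximal ideal. -/
def IsParameterIdeal [IsLocalRing R] (Q : Ideal R) : Prop :=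
  (∃ a : R, Q = Ideal.span {a}) ∧ Q.radical = IsLocalRing.maximalIdeal R

/-- `Q` is a reduction of the ideal `I`: `Q ⊆ I` and `I ^ (n + 1) = Q I ^ n` for some `n`. -/
def IsReduction (Q I : Ideal R) : Prop :=
  Q ≤ I ∧ ∃ n : ℕ, I ^ (n + 1) = Q * I ^ n

/-- The reduction number `r_Q(I) = min {n ≥ 0 | I ^ (n + 1) = Q I ^ n}` of `I` with respect to a
reduction `Q`. -/
def reductionNumber (Q I : Ideal R) : ℕ :=
  sInf {n : ℕ | I ^ (n + 1) = Q * I ^ n}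

/-- `e₀` and `e₁` are the Hilbert coefficients of the ideal `I` of a one-dimensional local ring:
for all large `n` the length of `R / I ^ (n + 1)` is finite and equal to
`e₀ * binom (n + 1) 1 - e₁`. -/
def HasHilbertCoefficients (I : Ideal R) (e₀ e₁ : ℤ) : Prop :=
  ∀ᶠ n : ℕ in Filter.atTop, ∃ l : ℕ, Module.length R (R ⧸ I ^ (n + 1)) = l ∧
    (l : ℤ) = e₀ * ((n + 1).choose 1 : ℤ) - e₁

/-- The Hilbert coefficients are determined by the ideal. -/
theorem HasHilbertCoefficients.unique {I : Ideal R} {e₀ e₁ f₀ f₁ : ℤ}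
    (h : HasHilbertCoefficients I e₀ e₁) (h' : HasHilbertCoefficients I f₀ f₁) :
    e₀ = f₀ ∧ e₁ = f₁ := by
  obtain ⟨N, hN⟩ := Filter.eventually_atTop.1 (h.and h')
  have key : ∀ n, N ≤ n → e₀ * ((n : ℤ) + 1) - e₁ = f₀ * ((n : ℤ) + 1) - f₁ := by
    intro n hn
    obtain ⟨⟨l, hl, h1⟩, ⟨l', hl', h2⟩⟩ := hN n hn
    have hll : l = l' := by
      rw [hl] at hl'
      exact_mod_cast hl'
    subst hll
    rw [h1] at h2
    simpa using h2
  have k1 := key N le_rfl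
  have k2 := key (N + 1) (Nat.le_succ N)
  push_cast at k2
  have h0 : e₀ = f₀ := by linarith
  subst h0
  exact ⟨rfl, by linarith⟩

/-- The fractional ideal `K = I / a = {x / a | x ∈ I}` in the total ring of fractions of `R`,
written as `{y | a y ∈ I}` (`a` is a non-zero-divisor of `R`). -/
def fractionalIdeal (I : Ideal R) (a : R) : Submodule R (FractionRing R) :=
  (Submodule.map (Algebra.linearMap R (FractionRing R)) I).comap
    (LinearMap.mulLeft R (algebraMap R (FractionRing R) a))

/-- For a non-zero-divisor `a`, the elements of `I / a` are the fractions `x / a` with `x ∈ I`. -/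
theorem mem_fractionalIdeal_iff (I : Ideal R) (a : nonZeroDivisors R) (y : FractionRing R) :
    y ∈ fractionalIdeal I (a : R) ↔ ∃ x ∈ I, y = IsLocalization.mk' (FractionRing R) x a := by
  simp only [fractionalIdeal, Submodule.mem_comap, Submodule.mem_map, Algebra.linearMap_apply,
    LinearMap.mulLeft_apply, IsLocalization.eq_mk'_iff_mul_eq]
  constructor
  · rintro ⟨x, hx, h⟩
    exact ⟨x, hx, by rw [h, mul_comm]⟩
  · rintro ⟨x, hx, h⟩
    exact ⟨x, hx, by rw [← h, mul_comm]⟩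

/-- The subring `S = R[K]` of the total ring of fractions, for `K = I / a`. -/
def fractionalAlgebra (I : Ideal R) (a : R) : Subalgebra R (FractionRing R) :=
  Algebra.adjoin R (fractionalIdeal I a : Set (FractionRing R))

/-- The conductor `𝔠 = R : S = {x | x S ⊆ R}`, as an ideal of `R` (every `x` in the total ring
of fractions with `x S ⊆ R` lies in `R`, since `1 ∈ S`). -/
def conductorIdeal (S : Subalgebra R (FractionRing R)) : Ideal R :=
  ((1 : Submodule R (FractionRing R)) / Subalgebra.toSubmodule S).comap
    (Algebra.linearMap R (FractionRing R))

/-- The length `ℓ_R(P / N)` for submodules `N ⊆ P`. -/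
def relativeLength {M : Type u} [AddCommGroup M] [Module R M] (N P : Submodule R M) : ℕ∞ :=
  Module.length R (SubmoduleQuotient N P)

/-- `I 𝓡`, where `𝓡 = R[It]` is the Rees algebra of `I`, as a module over the Rees algebra
`𝓣 = R[Qt]` of `Q` inside `R[t]`. -/
def idealMulRees (Q I : Ideal R) : Submodule (reesAlgebra Q) R[X] :=
  Submodule.span (reesAlgebra Q) {f | ∃ c ∈ I, ∃ g ∈ reesAlgebra I, f = C c * g}

/-- `I 𝓣`, where `𝓣 = R[Qt]` is the Rees algebra of `Q`, as a `𝓣`-submodule of `R[t]`. -/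
def idealMulReesBase (Q I : Ideal R) : Submodule (reesAlgebra Q) R[X] :=
  Submodule.span (reesAlgebra Q) {f | ∃ c ∈ I, f = C c}

theorem idealMulReesBase_le (Q I : Ideal R) : idealMulReesBase Q I ≤ idealMulRees Q I :=
  Submodule.span_mono fun _ ⟨c, hc, hf⟩ => ⟨c, hc, 1, (reesAlgebra I).one_mem, by rw [hf, mul_one]⟩

/-- The Sally module `I 𝓡 / I 𝓣` of `I` with respect to `Q`, a module over `𝓣 = R[Qt]`. -/
abbrev SallyModule (Q I : Ideal R) : Type u :=
  SubmoduleQuotient (idealMulReesBase Q I) (idealMulRees Q I)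

/-- The ideal `𝔭 = 𝔪 𝓣` of the Rees algebra `𝓣 = R[Qt]`. -/
def maximalIdealMulRees [IsLocalRing R] (Q : Ideal R) : Ideal (reesAlgebra Q) :=
  (IsLocalRing.maximalIdeal R).map (algebraMap R (reesAlgebra Q))

/-- The rank of the Sally module: the length over `𝓣_𝔭` of its localization at the prime
`𝔭 = 𝔪 𝓣`. -/
def sallyRank [IsLocalRing R] (Q I : Ideal R) [(maximalIdealMulRees Q).IsPrime] : ℕ∞ :=
  Module.length (Localization.AtPrime (maximalIdealMulRees Q))
    (LocalizedModule (maximalIdealMulRees Q).primeCompl (SallyModule Q I))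

end

/-! Write `A` for the total ring of fractions. Cohen–Macaulayness makes `a` a non-zero-divisor,
hence a unit `u` of `A`. The modules to be compared become lattices in `A`: submodules `F` with `u^n
R ⊆ F` and `u^n F ⊆ R` for some `n`. Nested lattices have finite relative length, and `ℓ(F/uF) =
ℓ(R/aR)` for every lattice `F`.

Since `1 ∈ K`, the powers of `K` increase, and `I^(n+1) = aI^n` means `K^(n+1) = K^n`. So `S = K^r`
for some `r`, and `I^n = u^n S` for `n ≥ r`. Hence `ℓ(R/I^n) = n ℓ(R/aR) - ℓ(S/R)`, that is, `e₀ =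
ℓ(R/aR)` and `e₁ = ℓ(S/R)`. The chain `aR ⊆ aK = I ⊆ R` gives `e₀ - ℓ(R/I) = ℓ(K/R)`, and `ℓ(S/R) -
ℓ(K/R) = ℓ(S/K)`.

Canonicity enters as type one: `(ω : 𝔪)/ω` embeds in `Ext¹(k, ω)`, so its length is at most one.
Filtering by socle elements then shows that `F ↦ ω : F` preserves lengths (`relativeLength_div_eq`),
whence `K : K = R`. As `KS = S`, this gives `K : S = (K : K) : S = 𝔠`, and dualising `K ⊆ S` yields
`ℓ(S/K) = ℓ(R/𝔠)`. By the same duality two lattices of type one differ by a unit of `A`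
(`exists_units_smul_eq`). Another choice of `I` and `a` therefore replaces `K` by some `vK`, and
stationarity of both sequences of powers forces `vS = S`; independence follows.

For the rank, each lattice `N` gives the `R[at]`-module of polynomials with `f_j ∈ a^(j+1) N`. For
`N = K` this is `I𝓣`; for `N = S` it agrees with `I𝓡` after localising at `𝔭`. Each socle step
between lattices adds one to the local length (`localizedRelativeLength_socle_step`), so the rank is
`ℓ(S/K)`. -/

noncomputable section

open CategoryTheory Polynomial

/-! ### Lengths of subquotients -/

section Subquotient

variable {T M : Type u} [CommRing T] [AddCommGroup M] [Module T M]

/-- The inclusion `P / N → L / N` for submodules `N ≤ P ≤ L`. -/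
def SubmoduleQuotient.inclusion (N : Submodule T M) {P L : Submodule T M} (h : P ≤ L) :
    SubmoduleQuotient N P →ₗ[T] SubmoduleQuotient N L :=
  Submodule.mapQ (N.submoduleOf P) (N.submoduleOf L) (Submodule.inclusion h) fun _ hx => hx

/-- The projection `L / N → L / P` for submodules `N ≤ P ≤ L`. -/
def SubmoduleQuotient.proj {N P : Submodule T M} (h : N ≤ P) (L : Submodule T M) :
    SubmoduleQuotient N L →ₗ[T] SubmoduleQuotient P L :=
  Submodule.mapQ (N.submoduleOf L) (P.submoduleOf L) LinearMap.id fun _ hx => h hx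

/-- The class in `P / N` of an element of `P`. -/
def SubmoduleQuotient.mk (N P : Submodule T M) : P →ₗ[T] SubmoduleQuotient N P :=
  (N.submoduleOf P).mkQ

theorem SubmoduleQuotient.mk_surjective (N P : Submodule T M) :
    Function.Surjective (SubmoduleQuotient.mk N P) :=
  Submodule.mkQ_surjective _

theorem SubmoduleQuotient.mk_eq_zero {N P : Submodule T M} {x : P} :
    SubmoduleQuotient.mk N P x = 0 ↔ (x : M) ∈ N :=
  Submodule.Quotient.mk_eq_zero _

theorem SubmoduleQuotient.inclusion_mk (N : Submodule T M) {P L : Submodule T M} (h : P ≤ L)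
    (x : P) : SubmoduleQuotient.inclusion N h (SubmoduleQuotient.mk N P x) =
      SubmoduleQuotient.mk N L (Submodule.inclusion h x) :=
  rfl

theorem SubmoduleQuotient.proj_mk {N P : Submodule T M} (h : N ≤ P) (L : Submodule T M)
    (x : L) : SubmoduleQuotient.proj h L (SubmoduleQuotient.mk N L x) =
      SubmoduleQuotient.mk P L x :=
  rfl

theorem SubmoduleQuotient.inclusion_injective (N : Submodule T M) {P L : Submodule T M}
    (h : P ≤ L) : Function.Injective (SubmoduleQuotient.inclusion N h) := by
  rw [injective_iff_map_eq_zero]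
  intro x hx
  obtain ⟨x, rfl⟩ := SubmoduleQuotient.mk_surjective N P x
  rw [inclusion_mk, mk_eq_zero] at hx
  exact mk_eq_zero.2 hx

theorem SubmoduleQuotient.proj_surjective {N P : Submodule T M} (h : N ≤ P)
    (L : Submodule T M) : Function.Surjective (SubmoduleQuotient.proj h L) := by
  intro x
  obtain ⟨x, rfl⟩ := SubmoduleQuotient.mk_surjective P L x
  exact ⟨SubmoduleQuotient.mk N L x, rfl⟩

theorem SubmoduleQuotient.exact {N P L : Submodule T M} (h : N ≤ P) (h' : P ≤ L) :
    Function.Exact (SubmoduleQuotient.inclusion N h') (SubmoduleQuotient.proj h L) := by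
  intro x
  obtain ⟨x, rfl⟩ := SubmoduleQuotient.mk_surjective N L x
  rw [proj_mk, mk_eq_zero]
  constructor
  · intro hx
    exact ⟨SubmoduleQuotient.mk N P ⟨x, hx⟩, rfl⟩
  · rintro ⟨y, hy⟩
    obtain ⟨y, rfl⟩ := SubmoduleQuotient.mk_surjective N P y
    rw [inclusion_mk, ← sub_eq_zero, ← map_sub, mk_eq_zero] at hy
    have := P.sub_mem y.2 (h hy)
    simpa using this

theorem relativeLength_add {N P L : Submodule T M} (h : N ≤ P) (h' : P ≤ L) :
    relativeLength N L = relativeLength N P + relativeLength P L :=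
  Module.length_eq_add_of_exact _ _ (SubmoduleQuotient.inclusion_injective N h')
    (SubmoduleQuotient.proj_surjective h L) (SubmoduleQuotient.exact h h')

theorem SubmoduleQuotient.subsingleton_iff {N P : Submodule T M} :
    Subsingleton (SubmoduleQuotient N P) ↔ P ≤ N := by
  constructor
  · intro h x hx
    have : SubmoduleQuotient.mk N P ⟨x, hx⟩ = 0 := Subsingleton.elim _ _
    exact mk_eq_zero.1 this
  · refine fun h => ⟨fun x y => ?_⟩
    obtain ⟨x, rfl⟩ := SubmoduleQuotient.mk_surjective N P x
    obtain ⟨y, rfl⟩ := SubmoduleQuotient.mk_surjective N P y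
    rw [← sub_eq_zero, ← map_sub]
    exact mk_eq_zero.2 (h (x - y).2)

theorem relativeLength_eq_zero_iff {N P : Submodule T M} : relativeLength N P = 0 ↔ P ≤ N :=
  Module.length_eq_zero_iff.trans SubmoduleQuotient.subsingleton_iff

/-- A linear map carrying `P` to `P'` and only the elements of `N` to `N'` bounds the length of
`P / N` by that of `P' / N'`. -/
theorem relativeLength_le_of_map {M' : Type u} [AddCommGroup M'] [Module T M']
    {N P : Submodule T M} {N' P' : Submodule T M'} (f : M →ₗ[T] M')
    (hP : ∀ x ∈ P, f x ∈ P') (hN : ∀ x ∈ P, f x ∈ N' ↔ x ∈ N) :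
    relativeLength N P ≤ relativeLength N' P' := by
  let g : SubmoduleQuotient N P →ₗ[T] SubmoduleQuotient N' P' :=
    Submodule.mapQ (N.submoduleOf P) (N'.submoduleOf P') (f.restrict hP)
      fun x hx => (hN x x.2).2 hx
  refine Module.length_le_of_injective g ?_
  rw [injective_iff_map_eq_zero]
  intro x hx
  obtain ⟨x, rfl⟩ := SubmoduleQuotient.mk_surjective N P x
  have hx' : SubmoduleQuotient.mk N' P' (f.restrict hP x) = 0 := hx
  rw [SubmoduleQuotient.mk_eq_zero] at hx' ⊢
  exact (hN x x.2).1 hx'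

theorem relativeLength_map {M' : Type u} [AddCommGroup M'] [Module T M']
    (N P : Submodule T M) (f : M →ₗ[T] M') (hf : Function.Injective f) :
    relativeLength (N.map f) (P.map f) = relativeLength N P := by
  refine le_antisymm ?_ (relativeLength_le_of_map f (fun x hx => ⟨x, hx, rfl⟩) fun x _ => ?_)
  · have h : ∀ x : P, f x ∈ P.map f := fun x => ⟨x, x.2, rfl⟩
    let g : SubmoduleQuotient N P →ₗ[T] SubmoduleQuotient (N.map f) (P.map f) :=
      Submodule.mapQ (N.submoduleOf P) ((N.map f).submoduleOf (P.map f))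
        (f.restrict fun x hx => ⟨x, hx, rfl⟩) fun x hx => ⟨x, hx, rfl⟩
    refine Module.length_le_of_surjective g fun y => ?_
    obtain ⟨⟨_, x, hx, rfl⟩, rfl⟩ := SubmoduleQuotient.mk_surjective _ _ y
    exact ⟨SubmoduleQuotient.mk N P ⟨x, hx⟩, rfl⟩
  · exact ⟨fun ⟨y, hy, h⟩ => hf h ▸ hy, fun h => ⟨x, h, rfl⟩⟩

theorem relativeLength_top (N : Submodule T M) :
    relativeLength N ⊤ = Module.length T (M ⧸ N) := by
  refine LinearEquiv.length_eq (Submodule.Quotient.equiv _ _ Submodule.topEquiv ?_)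
  ext x
  simp [Submodule.submoduleOf]

theorem Module.length_eq_one_of_cyclic [IsLocalRing T] (y : M) (hy : y ≠ 0)
    (hspan : ∀ x : M, ∃ c : T, x = c • y)
    (hm : ∀ c ∈ IsLocalRing.maximalIdeal T, c • y = 0) : Module.length T M = 1 := by
  rw [Module.length_eq_one_iff, isSimpleModule_iff_toSpanSingleton_surjective]
  refine ⟨⟨y, 0, hy⟩, fun x hx z => ?_⟩
  obtain ⟨c, rfl⟩ := hspan x
  obtain ⟨d, rfl⟩ := hspan z
  have hc : IsUnit c := by
    by_contra h
    exact hx (hm c ((IsLocalRing.mem_maximalIdeal c).2 h))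
  obtain ⟨c, rfl⟩ := hc
  exact ⟨d * (c⁻¹ : Tˣ), by simp [mul_smul, ← Units.smul_def]⟩

/-- The elementary step of the socle filtrations: the quotient is a copy of the residue field. -/
theorem relativeLength_sup_span_singleton [IsLocalRing T] (N : Submodule T M) (y : M)
    (hy : y ∉ N) (hm : ∀ c ∈ IsLocalRing.maximalIdeal T, c • y ∈ N) :
    relativeLength N (N ⊔ Submodule.span T {y}) = 1 := by
  have hyP : y ∈ N ⊔ Submodule.span T {y} :=
    Submodule.mem_sup_right (Submodule.mem_span_singleton_self y)
  refine Module.length_eq_one_of_cyclic (SubmoduleQuotient.mk N _ ⟨y, hyP⟩) ?_ ?_ ?_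
  · rwa [Ne, SubmoduleQuotient.mk_eq_zero]
  · intro x
    obtain ⟨⟨x, hx⟩, rfl⟩ := SubmoduleQuotient.mk_surjective _ _ x
    obtain ⟨z, hz, w, hw, rfl⟩ := Submodule.mem_sup.1 hx
    obtain ⟨c, rfl⟩ := Submodule.mem_span_singleton.1 hw
    refine ⟨c, ?_⟩
    rw [← map_smul, ← sub_eq_zero, ← map_sub, SubmoduleQuotient.mk_eq_zero]
    simpa using hz
  · intro c hc
    rw [← map_smul, SubmoduleQuotient.mk_eq_zero]
    exact hm c hc

end Subquotient

/-! ### Lattices in an overring and their relative lengths -/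

section Lattice

open scoped Pointwise

variable {R A : Type u} [CommRing R] [CommRing A] [Algebra R A]

theorem mem_units_smul_iff {u : Aˣ} {N : Submodule R A} {x : A} :
    x ∈ u • N ↔ (u⁻¹ : Aˣ) * x ∈ N := by
  change x ∈ (u : A) • N ↔ _
  rw [Submodule.mem_smul_pointwise_iff_exists]
  constructor
  · rintro ⟨s, hs, rfl⟩
    simpa using hs
  · intro h
    exact ⟨_, h, by simp⟩

theorem mul_mem_units_smul {u : Aˣ} {N : Submodule R A} {x : A} (hx : x ∈ N) :
    (u : A) * x ∈ u • N :=
  Submodule.smul_mem_pointwise_smul x u N hx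

theorem mul_mem_units_smul_iff {u : Aˣ} {N : Submodule R A} {x : A} :
    (u : A) * x ∈ u • N ↔ x ∈ N := by
  simp [mem_units_smul_iff]

theorem units_smul_le_units_smul_iff {u : Aˣ} {N P : Submodule R A} :
    u • N ≤ u • P ↔ N ≤ P := by
  constructor
  · intro h x hx
    exact mul_mem_units_smul_iff.1 (h (mul_mem_units_smul hx))
  · intro h x hx
    rw [mem_units_smul_iff] at hx ⊢
    exact h hx

theorem units_smul_le_iff {u : Aˣ} {N P : Submodule R A} :
    u • N ≤ P ↔ N ≤ u⁻¹ • P := by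
  rw [← units_smul_le_units_smul_iff (u := u⁻¹), inv_smul_smul]

theorem units_smul_mul (u : Aˣ) (N P : Submodule R A) : (u • N) * P = u • (N * P) := by
  apply le_antisymm
  · rw [Submodule.mul_le]
    intro x hx y hy
    rw [mem_units_smul_iff] at hx ⊢
    rw [← mul_assoc]
    exact Submodule.mul_mem_mul hx hy
  · rw [units_smul_le_iff, Submodule.mul_le]
    intro x hx y hy
    rw [mem_units_smul_iff, inv_inv, ← mul_assoc]
    exact Submodule.mul_mem_mul (mul_mem_units_smul hx) hy

theorem units_smul_pow (u : Aˣ) (N : Submodule R A) (n : ℕ) : (u • N) ^ n = u ^ n • N ^ n := by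
  induction n with
  | zero => simp
  | succ n ih =>
    rw [pow_succ, ih, units_smul_mul, mul_comm, units_smul_mul, smul_smul, mul_comm N, pow_succ N,
      pow_succ u]

theorem div_units_smul (N P : Submodule R A) (u : Aˣ) : N / (u • P) = u⁻¹ • (N / P) := by
  ext x
  rw [mem_units_smul_iff, inv_inv, Submodule.mem_div_iff_forall_mul_mem,
    Submodule.mem_div_iff_forall_mul_mem]
  constructor
  · intro h y hy
    have := h _ (mul_mem_units_smul hy)
    rwa [← mul_assoc, mul_comm x] at this
  · intro h y hy
    have := h _ (mem_units_smul_iff.1 hy)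
    convert this using 1
    rw [mul_comm (u : A) x, mul_assoc, Units.mul_inv_cancel_left]

theorem units_smul_div (N P : Submodule R A) (u : Aˣ) : (u • N) / P = u • (N / P) := by
  ext x
  rw [mem_units_smul_iff, Submodule.mem_div_iff_forall_mul_mem,
    Submodule.mem_div_iff_forall_mul_mem]
  simp only [mem_units_smul_iff, mul_assoc]

theorem div_le_div_left_of_le (N : Submodule R A) {G F : Submodule R A} (h : G ≤ F) :
    N / F ≤ N / G := by
  intro x hx
  rw [Submodule.mem_div_iff_forall_mul_mem] at hx ⊢
  exact fun y hy => hx y (h hy)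

theorem le_div_div_self (N F : Submodule R A) : F ≤ N / (N / F) := by
  intro x hx
  rw [Submodule.mem_div_iff_forall_mul_mem]
  intro y hy
  rw [mul_comm]
  exact Submodule.mem_div_iff_forall_mul_mem.1 hy x hx

theorem div_one_eq_self (N : Submodule R A) : N / (1 : Submodule R A) = N := by
  ext x
  rw [Submodule.mem_div_iff_forall_mul_mem]
  constructor
  · intro h
    simpa using h 1 (Submodule.one_le.1 le_rfl)
  · rintro h y hy
    obtain ⟨c, rfl⟩ := Submodule.mem_one.1 hy
    rw [mul_comm, ← Algebra.smul_def]
    exact N.smul_mem c h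

theorem relativeLength_units_smul (u : Aˣ) (N P : Submodule R A) :
    relativeLength (u • N) (u • P) = relativeLength N P :=
  relativeLength_map N P (DistribSMul.toLinearMap R A (u : A)) fun _ _ h =>
    u.isUnit.mul_left_cancel h

/-- `u` is the image of an element of `R`. -/
abbrev IsIntegralUnit (R : Type u) {A : Type u} [CommRing R] [CommRing A] [Algebra R A]
    (u : Aˣ) : Prop :=
  ∃ a : R, algebraMap R A a = u

theorem IsIntegralUnit.smul_le {u : Aˣ} (hu : IsIntegralUnit R u) (N : Submodule R A) :
    u • N ≤ N := by
  obtain ⟨a, ha⟩ := hu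
  intro x hx
  rw [mem_units_smul_iff] at hx
  have := N.smul_mem a hx
  rwa [Algebra.smul_def, ha, Units.mul_inv_cancel_left] at this

theorem IsIntegralUnit.pow {u : Aˣ} (hu : IsIntegralUnit R u) (n : ℕ) :
    IsIntegralUnit R (u ^ n) := by
  obtain ⟨a, ha⟩ := hu
  exact ⟨a ^ n, by simp [ha]⟩

theorem relativeLength_pow_smul {u : Aˣ} (hu : IsIntegralUnit R u) (N : Submodule R A) (n : ℕ) :
    relativeLength (u ^ n • N) N = n * relativeLength (u • N) N := by
  induction n with
  | zero => simpa using relativeLength_eq_zero_iff.2 le_rfl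
  | succ n ih =>
    rw [relativeLength_add (P := u ^ n • N) _ ((hu.pow n).smul_le N), ih, pow_succ, mul_smul,
      relativeLength_units_smul, Nat.cast_succ, add_mul, one_mul, add_comm]
    rw [pow_succ, mul_smul, units_smul_le_units_smul_iff]
    exact hu.smul_le N

/-- `F` is commensurable with `R` up to powers of the unit `u`. -/
def IsLatticeFor (u : Aˣ) (F : Submodule R A) : Prop :=
  ∃ n : ℕ, u ^ n • (1 : Submodule R A) ≤ F ∧ u ^ n • F ≤ 1

theorem units_pow_smul_antitone {u : Aˣ} (hu : IsIntegralUnit R u) (N : Submodule R A) {m n : ℕ}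
    (h : m ≤ n) : u ^ n • N ≤ u ^ m • N := by
  obtain ⟨k, rfl⟩ := Nat.exists_eq_add_of_le h
  rw [pow_add, mul_smul, units_smul_le_units_smul_iff]
  exact (hu.pow k).smul_le N

variable {u : Aˣ} (hu : IsIntegralUnit R u)

theorem isLatticeFor_one : IsLatticeFor u (1 : Submodule R A) := ⟨0, by simp, by simp⟩

theorem IsLatticeFor.div {N F : Submodule R A} (hN : IsLatticeFor u N) (hF : IsLatticeFor u F) :
    IsLatticeFor u (N / F) := by
  obtain ⟨n, hn1, hn2⟩ := hN
  obtain ⟨m, hm1, hm2⟩ := hF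
  refine ⟨n + m, ?_, ?_⟩
  · rw [Submodule.le_div_iff_mul_le, units_smul_mul, one_mul, pow_add, mul_smul]
    exact (units_smul_le_units_smul_iff.2 hm2).trans hn1
  · rw [units_smul_le_iff]
    intro x hx
    -- An element `x` of `N : F` is tested only on `u ^ m ∈ F`.
    have h1 : ((u ^ m : Aˣ) : A) ∈ F := by
      have := hm1 (mul_mem_units_smul (u := u ^ m) (Submodule.one_le.1 le_rfl))
      simpa using this
    have h2 := hn2 (mul_mem_units_smul (Submodule.mem_div_iff_forall_mul_mem.1 hx _ h1))
    rw [mem_units_smul_iff, inv_inv]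
    convert h2 using 1
    push_cast
    ring

theorem IsLatticeFor.mul {N F : Submodule R A} (hN : IsLatticeFor u N) (hF : IsLatticeFor u F) :
    IsLatticeFor u (N * F) := by
  obtain ⟨n, hn1, hn2⟩ := hN
  obtain ⟨m, hm1, hm2⟩ := hF
  have key : ∀ P : Submodule R A, u ^ (n + m) • (P * F) = (u ^ n • P) * (u ^ m • F) := by
    intro P
    rw [units_smul_mul, mul_comm P, mul_comm P, units_smul_mul, smul_smul, pow_add]
  refine ⟨n + m, ?_, ?_⟩
  · have : u ^ (n + m) • (1 : Submodule R A) = (u ^ n • 1) * (u ^ m • 1) := by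
      rw [units_smul_mul, one_mul, smul_smul, pow_add]
    rw [this]
    exact mul_le_mul' hn1 hm1
  · rw [key]
    exact (mul_le_mul' hn2 hm2).trans (one_mul _).le

theorem IsLatticeFor.pow {N : Submodule R A} (hN : IsLatticeFor u N) (n : ℕ) :
    IsLatticeFor u (N ^ n) := by
  induction n with
  | zero => simpa using isLatticeFor_one
  | succ n ih => rw [pow_succ]; exact ih.mul hN

include hu

theorem IsLatticeFor.eventually {F : Submodule R A} (hF : IsLatticeFor u F) :
    ∃ n : ℕ, ∀ m, n ≤ m → u ^ m • (1 : Submodule R A) ≤ F ∧ u ^ m • F ≤ 1 := by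
  obtain ⟨n, h1, h2⟩ := hF
  exact ⟨n, fun m hm => ⟨(units_pow_smul_antitone hu _ hm).trans h1,
    (units_pow_smul_antitone hu _ hm).trans h2⟩⟩

theorem IsLatticeFor.between {G F H : Submodule R A} (hG : IsLatticeFor u G)
    (hH : IsLatticeFor u H) (h : G ≤ F) (h' : F ≤ H) : IsLatticeFor u F := by
  obtain ⟨n, hn⟩ := hG.eventually hu
  obtain ⟨m, hm⟩ := hH.eventually hu
  exact ⟨max n m, (hn _ (le_max_left _ _)).1.trans h,
    (units_smul_le_units_smul_iff.2 h').trans (hm _ (le_max_right _ _)).2⟩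

theorem IsLatticeFor.pow_smul {F : Submodule R A} (hF : IsLatticeFor u F) (k : ℕ) :
    IsLatticeFor u (u ^ k • F) := by
  obtain ⟨n, h1, h2⟩ := hF
  refine ⟨n + k, ?_, ?_⟩
  · rw [add_comm, pow_add, mul_smul, units_smul_le_units_smul_iff]
    exact h1
  · rw [smul_smul, pow_add, mul_assoc, ← pow_add, mul_comm, mul_smul]
    exact ((hu.pow _).smul_le _).trans h2

theorem IsLatticeFor.inv_pow_smul {F : Submodule R A} (hF : IsLatticeFor u F) (k : ℕ) :
    IsLatticeFor u ((u ^ k)⁻¹ • F) := by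
  obtain ⟨n, h1, h2⟩ := hF
  refine ⟨n + k, ?_, ?_⟩
  · rw [← units_smul_le_iff]
    exact ((hu.pow _).smul_le _).trans ((units_pow_smul_antitone hu 1 le_self_add).trans h1)
  · rw [pow_add, mul_smul, smul_inv_smul]
    exact h2

variable (hfin : relativeLength (u • (1 : Submodule R A)) 1 ≠ ⊤)
include hfin

/-- Sandwich: `u^(m+n) R ⊆ u^m G ⊆ u^m F ⊆ R`, where the outer length is `(m+n) ℓ(R/uR)`. -/
theorem IsLatticeFor.relativeLength_ne_top {G F : Submodule R A} (hG : IsLatticeFor u G)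
    (hF : IsLatticeFor u F) (h : G ≤ F) : relativeLength G F ≠ ⊤ := by
  obtain ⟨n, hn, -⟩ := hG
  obtain ⟨m, -, hm⟩ := hF
  have h1 : relativeLength (u ^ (m + n) • (1 : Submodule R A)) 1 ≠ ⊤ := by
    rw [relativeLength_pow_smul hu]
    exact WithTop.mul_ne_top (ENat.natCast_ne_top _) hfin
  have h2 : u ^ (m + n) • (1 : Submodule R A) ≤ u ^ m • G := by
    rw [pow_add, mul_smul]
    exact units_smul_le_units_smul_iff.2 hn
  have h3 : u ^ m • G ≤ u ^ m • F := units_smul_le_units_smul_iff.2 h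
  rw [relativeLength_add (h2.trans h3) hm, relativeLength_add h2 h3,
    relativeLength_units_smul] at h1
  exact fun h => h1 (by simp [h])

/-- For `G = u^n R ⊆ F`, the length of `F/uG` is computed through `G` and through `uF`; the common
finite term `ℓ(F/G) = ℓ(uF/uG)` cancels. -/
theorem IsLatticeFor.relativeLength_smul_self {F : Submodule R A} (hF : IsLatticeFor u F) :
    relativeLength (u • F) F = relativeLength (u • (1 : Submodule R A)) 1 := by
  obtain ⟨n, hn, hn'⟩ := hF
  set G := u ^ n • (1 : Submodule R A) with hG
  have h1 : relativeLength (u • G) F = relativeLength (u • G) G + relativeLength G F :=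
    relativeLength_add (hu.smul_le _) hn
  have h2 : relativeLength (u • G) F = relativeLength G F + relativeLength (u • F) F := by
    rw [relativeLength_add (units_smul_le_units_smul_iff.2 hn) (hu.smul_le _),
      relativeLength_units_smul]
  have h3 : relativeLength (u • G) G = relativeLength (u • (1 : Submodule R A)) 1 := by
    rw [hG, smul_smul, mul_comm, mul_smul, relativeLength_units_smul]
  have h4 : relativeLength G F ≠ ⊤ :=
    IsLatticeFor.relativeLength_ne_top hu hfin (isLatticeFor_one.pow_smul hu n) ⟨n, hn, hn'⟩ hn
  rw [h1, add_comm, h3] at h2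
  exact (WithTop.add_left_cancel h4 h2).symm

end Lattice

/-! ### Duality into a lattice of type one -/

section Duality

open scoped Pointwise

variable {R A : Type u} [CommRing R] [CommRing A] [Algebra R A] [IsLocalRing R]

/-- The maximal ideal of `R`, viewed in the `R`-algebra `A`. -/
abbrev maximalIdealIn (R A : Type u) [CommRing R] [CommRing A] [Algebra R A] [IsLocalRing R] :
    Submodule R A :=
  Submodule.map (Algebra.linearMap R A) (IsLocalRing.maximalIdeal R)

theorem mem_div_maximalIdealIn {N : Submodule R A} {x : A} :
    x ∈ N / maximalIdealIn R A ↔ ∀ c ∈ IsLocalRing.maximalIdeal R, c • x ∈ N := by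
  rw [Submodule.mem_div_iff_forall_mul_mem]
  constructor
  · intro h c hc
    have := h _ ⟨c, hc, rfl⟩
    rwa [Algebra.linearMap_apply, mul_comm, ← Algebra.smul_def] at this
  · rintro h _ ⟨c, hc, rfl⟩
    rw [Algebra.linearMap_apply, mul_comm, ← Algebra.smul_def]
    exact h c hc

variable {u : Aˣ} (hu : IsIntegralUnit R u)
  (hm : ∃ j : ℕ, ∀ c ∈ IsLocalRing.maximalIdeal R ^ j, ∃ d : R, algebraMap R A c =
    algebraMap R A d * u)

include hm in
/-- A socle element of `F / G`, for lattices `G < F`. -/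
theorem IsLatticeFor.exists_socle {G F : Submodule R A} (hG : IsLatticeFor u G)
    (hF : IsLatticeFor u F) (h : ¬ F ≤ G) :
    ∃ y ∈ F, y ∉ G ∧ ∀ c ∈ IsLocalRing.maximalIdeal R, c • y ∈ G := by
  classical
  obtain ⟨j, hj⟩ := hm
  obtain ⟨n, hn, -⟩ := hG
  obtain ⟨m, -, hm⟩ := hF
  have hpow : ∀ k, ∀ c ∈ (IsLocalRing.maximalIdeal R ^ j) ^ k, ∃ d : R, algebraMap R A c =
      algebraMap R A d * (u : A) ^ k := by
    intro k
    induction k with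
    | zero => exact fun c _ => ⟨c, by simp⟩
    | succ k ih =>
      intro c hc
      rw [pow_succ] at hc
      refine Submodule.mul_induction_on hc ?_ ?_
      · intro x hx y hy
        obtain ⟨d, hd⟩ := ih x hx
        obtain ⟨e, he⟩ := hj y hy
        exact ⟨d * e, by rw [map_mul, map_mul, hd, he]; ring⟩
      · rintro x y ⟨d, hd⟩ ⟨e, he⟩
        exact ⟨d + e, by rw [map_add, map_add, hd, he]; ring⟩
  -- Since `𝔪^j ⊆ uR`, one has `𝔪^(j(n+m)) F ⊆ u^n (u^m F) ⊆ u^n R ⊆ G`. For the least `k` with `𝔪^k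
  -- F ⊆ G`, any element of `𝔪^(k-1) F` outside `G` is a socle element.
  have hex : ∃ k : ℕ, IsLocalRing.maximalIdeal R ^ k • F ≤ G := by
    refine ⟨j * (n + m), Submodule.smul_le.2 fun c hc x hx => ?_⟩
    rw [pow_mul] at hc
    obtain ⟨d, hd⟩ := hpow _ c hc
    have h1 := hn (mul_mem_units_smul (u := u ^ n) (hm (mul_mem_units_smul (u := u ^ m) hx)))
    have h2 := G.smul_mem d h1
    rw [Algebra.smul_def] at h2 ⊢
    rw [hd]
    convert h2 using 1
    push_cast
    ring
  have hspec := Nat.find_spec hex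
  obtain hk | hk := Nat.eq_zero_or_pos (Nat.find hex)
  · rw [hk, pow_zero, Ideal.one_eq_top, Submodule.top_smul] at hspec
    exact absurd hspec h
  · obtain ⟨k, hk⟩ := Nat.exists_eq_add_one.2 hk
    rw [hk] at hspec
    obtain ⟨y, hy, hyG⟩ := SetLike.not_le_iff_exists.1 (Nat.find_min hex (m := k) (by omega))
    refine ⟨y, Submodule.smul_le_right hy, hyG, fun c hc => hspec ?_⟩
    rw [pow_succ', mul_smul]
    exact Submodule.smul_mem_smul hc hy

include hu hm in
-- Induction on the finite length of `F/G`: the upper lattice stays fixed while the lower one grows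
-- by one socle element.
theorem IsLatticeFor.induction_socle
    (hfin : relativeLength (u • (1 : Submodule R A)) 1 ≠ ⊤)
    {motive : Submodule R A → Submodule R A → Prop}
    (refl : ∀ G, IsLatticeFor u G → motive G G)
    (step : ∀ G F y, IsLatticeFor u G → IsLatticeFor u F → y ∉ G →
      (∀ c ∈ IsLocalRing.maximalIdeal R, c • y ∈ G) → G ⊔ Submodule.span R {y} ≤ F →
      IsLatticeFor u (G ⊔ Submodule.span R {y}) →
      relativeLength G (G ⊔ Submodule.span R {y}) = 1 →
      motive (G ⊔ Submodule.span R {y}) F → motive G F)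
    {G F : Submodule R A} (hG : IsLatticeFor u G)
    (hF : IsLatticeFor u F) (h : G ≤ F) : motive G F := by
  obtain ⟨n, hn⟩ := ENat.ne_top_iff_exists.1 (hG.relativeLength_ne_top hu hfin hF h)
  induction n using Nat.strong_induction_on generalizing G with
  | _ n ih =>
    by_cases hFG : F ≤ G
    · rw [le_antisymm hFG h]
      exact refl G hG
    · obtain ⟨y, hyF, hyG, hy⟩ := hG.exists_socle hm hF hFG
      have h1 := relativeLength_sup_span_singleton G y hyG hy
      have hle : G ⊔ Submodule.span R {y} ≤ F :=
        sup_le h ((Submodule.span_singleton_le_iff_mem _ _).2 hyF)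
      have hlat : IsLatticeFor u (G ⊔ Submodule.span R {y}) := hG.between hu hF le_sup_left hle
      obtain ⟨k, hk⟩ := ENat.ne_top_iff_exists.1 (hlat.relativeLength_ne_top hu hfin hF hle)
      refine step G F y hG hF hyG hy hle hlat h1 (ih k ?_ hlat hle hk)
      rw [relativeLength_add le_sup_left hle, h1, ← hk] at hn
      have : n = 1 + k := by exact_mod_cast hn
      omega

variable {ω : Submodule R A} (hω : relativeLength ω (ω / maximalIdealIn R A) ≤ 1)

include hω in
-- Multiplication by `y` sends `ω : G` into `ω : 𝔪` because `𝔪y ⊆ G`, and `xy ∈ ω` holds exactly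
-- when `x` carries all of `G + Ry` into `ω`. Type one bounds the target.
theorem relativeLength_div_socle_le (G : Submodule R A) (y : A)
    (hy : ∀ c ∈ IsLocalRing.maximalIdeal R, c • y ∈ G) :
    relativeLength (ω / (G ⊔ Submodule.span R {y})) (ω / G) ≤ 1 := by
  refine le_trans (relativeLength_le_of_map (LinearMap.mulRight R y) ?_ ?_) hω
  · intro x hx
    rw [mem_div_maximalIdealIn]
    intro c hc
    rw [LinearMap.mulRight_apply, ← mul_smul_comm]
    exact Submodule.mem_div_iff_forall_mul_mem.1 hx _ (hy c hc)
  · intro x hx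
    rw [LinearMap.mulRight_apply, Submodule.mem_div_iff_forall_mul_mem]
    rw [Submodule.mem_div_iff_forall_mul_mem] at hx
    constructor
    · intro hxy z hz
      obtain ⟨g, hg, w, hw, rfl⟩ := Submodule.mem_sup.1 hz
      obtain ⟨c, rfl⟩ := Submodule.mem_span_singleton.1 hw
      rw [mul_add, mul_smul_comm]
      exact ω.add_mem (hx g hg) (ω.smul_mem c hxy)
    · intro h
      exact h y (Submodule.mem_sup_right (Submodule.mem_span_singleton_self y))

variable (hfin : relativeLength (u • (1 : Submodule R A)) 1 ≠ ⊤)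
include hu hm hω hfin

theorem relativeLength_div_le {G F : Submodule R A} (hG : IsLatticeFor u G)
    (hF : IsLatticeFor u F) (h : G ≤ F) :
    relativeLength (ω / F) (ω / G) ≤ relativeLength G F := by
  refine IsLatticeFor.induction_socle hu hm hfin
    (motive := fun G F => relativeLength (ω / F) (ω / G) ≤ relativeLength G F) ?_ ?_ hG hF h
  · intro G _
    simp [relativeLength_eq_zero_iff.2 le_rfl]
  · intro G F y hG hF _ hy hle _ h1 ih
    rw [relativeLength_add (div_le_div_left_of_le ω hle) (div_le_div_left_of_le ω le_sup_left),
      relativeLength_add le_sup_left hle, add_comm, h1]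
    exact add_le_add (relativeLength_div_socle_le hω G y hy) ih

variable (hωl : IsLatticeFor u ω)
include hωl

/-- Duality into a fractional ideal of type one preserves lengths. -/
theorem relativeLength_div_eq {G F : Submodule R A} (hG : IsLatticeFor u G)
    (hF : IsLatticeFor u F) (h : G ≤ F) :
    relativeLength (ω / F) (ω / G) = relativeLength G F := by
  -- For `H = u^(-n) G ⊇ F`, both `ℓ(H/G)` and the length of its dual equal `n ℓ(R/uR)`. The
  -- inequalities for `G ⊆ F` and `F ⊆ H` thus add up to an equality of finite lengths, so each is
  -- an equality.
  obtain ⟨n, hn⟩ : ∃ n : ℕ, F ≤ (u ^ n)⁻¹ • G := by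
    obtain ⟨n, hn, -⟩ := hG
    obtain ⟨m, -, hm⟩ := hF
    refine ⟨n + m, ?_⟩
    rw [← units_smul_le_iff, pow_add, mul_smul]
    exact (units_smul_le_units_smul_iff.2 hm).trans hn
  set H := (u ^ n)⁻¹ • G with hH
  have hHl : IsLatticeFor u H := hG.inv_pow_smul hu n
  have h1 : relativeLength G H = n * relativeLength (u • (1 : Submodule R A)) 1 := by
    rw [← relativeLength_units_smul (u ^ n) G H, hH, smul_inv_smul,
      relativeLength_pow_smul hu, hG.relativeLength_smul_self hu hfin]
  have h2 : relativeLength (ω / H) (ω / G) =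
      n * relativeLength (u • (1 : Submodule R A)) 1 := by
    rw [hH, div_units_smul, inv_inv, relativeLength_pow_smul hu,
      (hωl.div hG).relativeLength_smul_self hu hfin]
  rw [← h1, relativeLength_add h hn,
    relativeLength_add (div_le_div_left_of_le ω hn) (div_le_div_left_of_le ω h)] at h2
  have h3 := relativeLength_div_le hu hm hω hfin hG hF h
  have h4 := relativeLength_div_le hu hm hω hfin hF hHl hn
  have h5 := hG.relativeLength_ne_top hu hfin hF h
  have h6 := hF.relativeLength_ne_top hu hfin hHl hn
  refine le_antisymm h3 ?_
  have h7 : relativeLength F H + relativeLength G F ≤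
      relativeLength F H + relativeLength (ω / F) (ω / G) := by
    rw [add_comm, ← h2]
    gcongr
  exact (ENat.add_le_add_iff_left h6).1 h7

/-- The inclusion of `F` in its bidual `D` has length `ℓ((ω : F)/(ω : D))`, which vanishes because
`ω : F` lies in its own bidual `ω : D`. -/
theorem div_div_self_eq {F : Submodule R A} (hF : IsLatticeFor u F) : ω / (ω / F) = F := by
  have hD : IsLatticeFor u (ω / (ω / F)) := hωl.div (hωl.div hF)
  have hle := le_div_div_self ω F
  have h1 := relativeLength_div_eq hu hm hω hfin hωl hF hD hle
  have h2 : ω / F ≤ ω / (ω / (ω / F)) := le_div_div_self ω _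
  rw [relativeLength_eq_zero_iff.2 h2, eq_comm, relativeLength_eq_zero_iff] at h1
  exact le_antisymm h1 hle

theorem div_self_eq_one : ω / ω = 1 := by
  have h1 := div_div_self_eq hu hm hω hfin hωl (isLatticeFor_one (R := R))
  rwa [div_one_eq_self] at h1

end Duality

/-! ### Type one from `Ext¹(k, -)` -/

section ExtStep

variable {R A : Type u} [CommRing R] [CommRing A] [Algebra R A] [IsLocalRing R]

variable (R) in
/-- The short complex `𝔪 → R → R / 𝔪`. -/
def residueFieldComplex : ShortComplex (ModuleCat.{u} R) :=
  ShortComplex.mk (ModuleCat.ofHom (IsLocalRing.maximalIdeal R).subtype)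
    (ModuleCat.ofHom (Algebra.linearMap R (IsLocalRing.ResidueField R))) (by
      ext x
      exact (IsLocalRing.residue_eq_zero_iff _).2 x.2)

variable (R) in
theorem residueFieldComplex_shortExact : (residueFieldComplex R).ShortExact := by
  have : Mono (residueFieldComplex R).f :=
    (ModuleCat.mono_iff_injective _).2 (Submodule.subtype_injective _)
  have : Epi (residueFieldComplex R).g :=
    (ModuleCat.epi_iff_surjective _).2 (IsLocalRing.residue_surjective (R := R))
  refine ShortComplex.ShortExact.mk ?_
  rw [ShortComplex.moduleCat_exact_iff]
  intro x hx
  exact ⟨⟨x, (IsLocalRing.residue_eq_zero_iff _).1 hx⟩, rfl⟩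

variable (R) in
/-- The class in `Ext¹(k, 𝔪)` of the extension `R` of `k` by `𝔪`. -/
def residueFieldExtClass : Abelian.Ext.{u} (ModuleCat.of R (IsLocalRing.ResidueField R))
    (ModuleCat.of R (IsLocalRing.maximalIdeal R)) 1 :=
  (residueFieldComplex_shortExact R).extClass

/-- The connecting map `Hom(𝔪, M) → Ext¹(k, M)`. -/
def extConnecting (M : Type u) [AddCommGroup M] [Module R M] :
    (IsLocalRing.maximalIdeal R →ₗ[R] M) →ₗ[R]
      Abelian.Ext.{u} (ModuleCat.of R (IsLocalRing.ResidueField R)) (ModuleCat.of R M) 1 where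
  toFun f := (residueFieldExtClass R).comp (Abelian.Ext.mk₀ (ModuleCat.ofHom f)) (add_zero 1)
  map_add' f g := by
    rw [← Abelian.Ext.comp_add, ← Abelian.Ext.mk₀_add, ← ModuleCat.ofHom_add]
  map_smul' r f := by
    rw [RingHom.id_apply, ← Abelian.Ext.comp_smul, ← Abelian.Ext.mk₀_smul]
    rfl

/-- By the long exact sequence of `0 → 𝔪 → R → k → 0`, such an `f` extends to `R`; the element `y`
is the value of the extension at `1`. -/
theorem exists_extension_of_extConnecting_eq_zero (M : Type u) [AddCommGroup M] [Module R M]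
    (f : IsLocalRing.maximalIdeal R →ₗ[R] M) (hf : extConnecting M f = 0) :
    ∃ y : M, ∀ c : IsLocalRing.maximalIdeal R, f c = (c : R) • y := by
  obtain ⟨x, hx⟩ := Abelian.Ext.contravariant_sequence_exact₁ (residueFieldComplex_shortExact R)
    (ModuleCat.of R M) (Abelian.Ext.mk₀ (ModuleCat.ofHom f)) (add_zero 1) hf
  obtain ⟨g, rfl⟩ := Abelian.Ext.addEquiv₀.symm.surjective x
  have h : (residueFieldComplex R).f ≫ g = ModuleCat.ofHom f := by
    apply Abelian.Ext.addEquiv₀.symm.injective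
    refine Eq.trans ?_ hx
    exact (Abelian.Ext.mk₀_comp_mk₀ _ _).symm
  let g' : R →ₗ[R] M := g.hom
  refine ⟨g' 1, fun c => ?_⟩
  have h2 : g' (c : R) = f c := congrArg (fun t => t.hom c) h
  rw [← h2, ← map_smul, smul_eq_mul, mul_one]

/-- Multiplication by the elements of `N : 𝔪`, as homomorphisms from `𝔪` to `N`. -/
def divMaximalIdealHom (N : Submodule R A) :
    ↥(N / maximalIdealIn R A) →ₗ[R] IsLocalRing.maximalIdeal R →ₗ[R] N :=
  LinearMap.mk₂ R (fun x c => ⟨(c : R) • (x : A), mem_div_maximalIdealIn.1 x.2 c c.2⟩)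
    (fun _ _ _ => Subtype.ext (smul_add _ _ _)) (fun _ _ _ => Subtype.ext (smul_comm _ _ _))
    (fun _ _ _ => Subtype.ext (add_smul _ _ _)) (fun _ _ _ => Subtype.ext (mul_smul _ _ _))

/-- Send `x ∈ N : 𝔪` to the image of `c ↦ cx` in `Ext¹(k, M)`. If it vanishes, `c ↦ cx` is also
multiplication by some `y ∈ N`; taking `c = a`, invertible in `A`, gives `x = y ∈ N`. So the length
of `(N : 𝔪)/N` is at most that of the image. -/
theorem relativeLength_div_maximalIdealIn_le (N : Submodule R A) {M : Type u} [AddCommGroup M]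
    [Module R M] (e : N ≃ₗ[R] M)
    {a : R} (ha : a ∈ IsLocalRing.maximalIdeal R) (hu : IsUnit (algebraMap R A a)) :
    relativeLength N (N / maximalIdealIn R A) ≤
      Module.length R (Abelian.Ext.{u} (ModuleCat.of R (IsLocalRing.ResidueField R))
        (ModuleCat.of R M) 1) := by
  let φ := extConnecting M ∘ₗ LinearMap.compRight R e.toLinearMap ∘ₗ divMaximalIdealHom N
  have hle : LinearMap.ker φ ≤ N.submoduleOf (N / maximalIdealIn R A) := by
    intro x hx
    obtain ⟨y, hy⟩ := exists_extension_of_extConnecting_eq_zero M _ hx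
    have h1 := hy ⟨a, ha⟩
    have h2 : e (divMaximalIdealHom N x ⟨a, ha⟩) = e (a • e.symm y) := by
      rw [map_smul, e.apply_symm_apply]
      exact h1
    have h3 : a • (x : A) = a • ((e.symm y : N) : A) := congrArg Subtype.val (e.injective h2)
    rw [Algebra.smul_def, Algebra.smul_def] at h3
    change (x : A) ∈ N
    rw [hu.mul_left_cancel h3]
    exact (e.symm y).2
  refine (Module.length_le_of_surjective (Submodule.factor hle)
    (Submodule.factor_surjective hle)).trans ?_
  rw [φ.quotKerEquivRange.length_eq]
  exact Module.length_le_of_injective _ (Submodule.subtype_injective _)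

end ExtStep

/-! ### Uniqueness of the type-one lattice up to a unit -/

section Uniqueness

open scoped Pointwise
open IsLocalization (coeSubmodule)

variable {R A : Type u} [CommRing R] [CommRing A] [Algebra R A]

theorem div_mul_eq_div_div_submodule (N P Q : Submodule R A) : N / (P * Q) = N / P / Q :=
  eq_of_forall_le_iff fun X => by
    rw [Submodule.le_div_iff_mul_le, Submodule.le_div_iff_mul_le, Submodule.le_div_iff_mul_le,
      mul_comm P, mul_assoc]

theorem IsLatticeFor.fg [IsNoetherianRing R] {u : Aˣ} {F : Submodule R A}
    (hF : IsLatticeFor u F) : F.FG := by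
  obtain ⟨n, -, hn⟩ := hF
  have h1 : (u ^ n • F).FG := by
    have : IsNoetherian R (1 : Submodule R A) := by
      rw [Submodule.one_eq_range]
      infer_instance
    rw [← Submodule.map_subtype_range_inclusion hn, LinearMap.range_eq_map]
    exact ((IsNoetherian.noetherian _ : Submodule.FG _)).map _
  have h2 := h1.map (DistribSMul.toLinearMap R A (((u ^ n)⁻¹ : Aˣ) : A))
  have h3 : (u ^ n • F).map (DistribSMul.toLinearMap R A (((u ^ n)⁻¹ : Aˣ) : A)) = F := by
    change (u ^ n)⁻¹ • u ^ n • F = F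
    rw [inv_smul_smul]
  rwa [h3] at h2

theorem units_smul_one_eq_span (v : Aˣ) :
    v • (1 : Submodule R A) = Submodule.span R {(v : A)} := by
  ext x
  rw [mem_units_smul_iff, Submodule.mem_one, Submodule.mem_span_singleton]
  simp only [Units.eq_inv_mul_iff_mul_eq, Algebra.smul_def, mul_comm (v : A)]

variable [IsLocalRing R] [IsNoetherianRing R] {u : Aˣ}
  (hum : ∃ a ∈ IsLocalRing.maximalIdeal R, algebraMap R A a = u)
  (hm : ∃ j : ℕ, ∀ c ∈ IsLocalRing.maximalIdeal R ^ j, ∃ d : R, algebraMap R A c =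
    algebraMap R A d * u)
  (hfin : relativeLength (u • (1 : Submodule R A)) 1 ≠ ⊤)

include hum hm hfin in
/-- Two fractional ideals of type one differ by a unit of the total ring of fractions. -/
theorem exists_units_smul_eq {ω ω' : Submodule R A}
    (hω : relativeLength ω (ω / maximalIdealIn R A) ≤ 1) (hωl : IsLatticeFor u ω)
    (hω' : relativeLength ω' (ω' / maximalIdealIn R A) ≤ 1) (hωl' : IsLatticeFor u ω') :
    ∃ v : Aˣ, ω' = v • ω := by
  obtain ⟨a, ham, ha⟩ := hum
  have hu : IsIntegralUnit R u := ⟨a, ha⟩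
  have hml : IsLatticeFor u (maximalIdealIn R A) := by
    have h1 : maximalIdealIn R A ≤ 1 := by
      rintro _ ⟨c, -, rfl⟩
      exact Submodule.mem_one.2 ⟨c, rfl⟩
    refine IsLatticeFor.between hu (isLatticeFor_one.pow_smul hu 1) isLatticeFor_one ?_ h1
    rw [pow_one, units_smul_one_eq_span, Submodule.span_singleton_le_iff_mem]
    exact ⟨a, ham, ha⟩
  set X := ω / ω' with hX
  have hXl : IsLatticeFor u X := hωl.div hωl'
  have hle : X * maximalIdealIn R A ≤ X := by
    rw [Submodule.mul_le]
    rintro x hx _ ⟨c, -, rfl⟩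
    rw [Algebra.linearMap_apply, mul_comm, ← Algebra.smul_def]
    exact X.smul_mem c hx
  have hmX : X * maximalIdealIn R A ≤ IsLocalRing.maximalIdeal R • X := by
    rw [Submodule.mul_le]
    rintro x hx _ ⟨c, hc, rfl⟩
    rw [Algebra.linearMap_apply, mul_comm, ← Algebra.smul_def]
    exact Submodule.smul_mem_smul hc hx
  have hXX : ω / X = ω' := div_div_self_eq hu hm hω hfin hωl hωl'
  -- The dual of `X𝔪` is `(ω : X) : 𝔪 = ω' : 𝔪`, so duality turns type one of `ω'` into cyclicity of
  -- `X` modulo `𝔪X`; Nakayama then makes `X` cyclic.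
  have hlen : relativeLength (X * maximalIdealIn R A) X ≤ 1 := by
    rw [← relativeLength_div_eq hu hm hω hfin hωl (hXl.mul hml) hXl hle,
      div_mul_eq_div_div_submodule, hXX]
    exact hω'
  obtain ⟨y, hyX, hy⟩ : ∃ y ∈ X, X ≤ Submodule.span R {y} ⊔ X * maximalIdealIn R A := by
    by_cases h : X ≤ X * maximalIdealIn R A
    · exact ⟨0, X.zero_mem, h.trans le_sup_right⟩
    · obtain ⟨y, hyX, hy⟩ := SetLike.not_le_iff_exists.1 h
      refine ⟨y, hyX, ?_⟩
      have h1 := relativeLength_sup_span_singleton (X * maximalIdealIn R A) y hy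
        fun c hc => by
          rw [Algebra.smul_def, mul_comm (algebraMap R A c)]
          exact Submodule.mul_mem_mul hyX ⟨c, hc, rfl⟩
      have h2 : X * maximalIdealIn R A ⊔ Submodule.span R {y} ≤ X :=
        sup_le hle ((Submodule.span_singleton_le_iff_mem _ _).2 hyX)
      rw [relativeLength_add le_sup_left h2, h1] at hlen
      have h3 : relativeLength (X * maximalIdealIn R A ⊔ Submodule.span R {y}) X = 0 := by
        have : (1 : ℕ∞) + relativeLength (X * maximalIdealIn R A ⊔ Submodule.span R {y}) X ≤
          1 + 0 := by simpa using hlen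
        exact le_antisymm ((ENat.add_le_add_iff_left ENat.one_ne_top).1 this) zero_le
      rw [sup_comm]
      exact relativeLength_eq_zero_iff.1 h3
  have hXy : X = Submodule.span R {y} :=
    le_antisymm (Submodule.le_of_le_smul_of_le_jacobson_bot hXl.fg
      (IsLocalRing.maximalIdeal_le_jacobson ⊥) (hy.trans (sup_le_sup_left hmX _)))
      ((Submodule.span_singleton_le_iff_mem _ _).2 hyX)
  -- The lattice `X = Ry` contains a power of `u`, so `y` divides a unit.
  have hyu : IsUnit y := by
    obtain ⟨n, hn, -⟩ := hXl
    have h1 : ((u ^ n : Aˣ) : A) ∈ X := by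
      have := hn (mul_mem_units_smul (u := u ^ n) (Submodule.one_le.1 le_rfl))
      simpa using this
    rw [hXy, Submodule.mem_span_singleton] at h1
    obtain ⟨c, hc⟩ := h1
    rw [Algebra.smul_def] at hc
    exact isUnit_of_mul_isUnit_right (hc ▸ (u ^ n).isUnit)
  obtain ⟨v, rfl⟩ := hyu
  refine ⟨v⁻¹, ?_⟩
  rw [← hXX, hXy, ← units_smul_one_eq_span, div_units_smul, div_one_eq_self]

end Uniqueness

/-! ### Stationary powers and the ring `R[K]` -/

section Blowup

open scoped Pointwise

variable {R A : Type u} [CommRing R] [CommRing A] [Algebra R A]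

theorem pow_mono_of_one_le {K : Submodule R A} (h1 : 1 ≤ K) {m n : ℕ} (h : m ≤ n) :
    K ^ m ≤ K ^ n := by
  obtain ⟨k, rfl⟩ := Nat.exists_eq_add_of_le h
  rw [pow_add]
  calc K ^ m = K ^ m * 1 := (mul_one _).symm
    _ ≤ K ^ m * K ^ k := mul_le_mul' le_rfl (by simpa using pow_le_pow_left' h1 k)

theorem pow_eq_pow_of_stable {K : Submodule R A} {r n : ℕ}
    (hr : K ^ (r + 1) = K ^ r) (h : r ≤ n) : K ^ n = K ^ r := by
  induction n, h using Nat.le_induction with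
  | base => rfl
  | succ n _ ih => rw [pow_succ, ih, ← pow_succ, hr]

theorem pow_le_adjoin (K : Submodule R A) (n : ℕ) :
    K ^ n ≤ Subalgebra.toSubmodule (Algebra.adjoin R (K : Set A)) := by
  induction n with
  | zero =>
    rw [pow_zero, Submodule.one_le]
    exact one_mem (Algebra.adjoin R (K : Set A))
  | succ n ih =>
    rw [pow_succ, Submodule.mul_le]
    exact fun x hx y hy =>
      (Algebra.adjoin R (K : Set A)).mul_mem (ih hx) (Algebra.subset_adjoin hy)

/-- If the powers of `K ∋ 1` become stationary, they reach the ring `R[K]`. -/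
theorem adjoin_eq_pow {K : Submodule R A} (h1 : 1 ≤ K) {r : ℕ} (hr : K ^ (r + 1) = K ^ r) :
    Subalgebra.toSubmodule (Algebra.adjoin R (K : Set A)) = K ^ r := by
  refine le_antisymm (fun x hx => ?_) (pow_le_adjoin K r)
  have h1r : 1 ≤ K ^ r := by simpa using pow_mono_of_one_le h1 (Nat.zero_le r)
  refine Algebra.adjoin_induction (p := fun x _ => x ∈ K ^ r) ?_ ?_ ?_ ?_ hx
  · intro x hx
    rw [← hr]
    have := pow_mono_of_one_le h1 (Nat.le_add_left 1 r)
    rw [pow_one] at this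
    exact this hx
  · intro c
    exact h1r (Submodule.mem_one.2 ⟨c, rfl⟩)
  · exact fun x y _ _ hx hy => add_mem hx hy
  · intro x y _ _ hx hy
    rw [← pow_eq_pow_of_stable hr (Nat.le_add_left r r), pow_add]
    exact Submodule.mul_mem_mul hx hy

/-- Characterises stationarity by the ring `R[K]`, which, unlike `K`, is unchanged under scaling by
the relevant units. -/
theorem stable_iff_eq_adjoin {K : Submodule R A} (h1 : 1 ≤ K) (n : ℕ) :
    K ^ (n + 1) = K ^ n ↔ K ^ n = Subalgebra.toSubmodule (Algebra.adjoin R (K : Set A)) := by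
  constructor
  · exact fun h => (adjoin_eq_pow h1 h).symm
  · intro h
    exact le_antisymm ((pow_le_adjoin K _).trans h.ge) (pow_mono_of_one_le h1 (Nat.le_succ n))

theorem mul_adjoin_eq {K : Submodule R A} (h1 : 1 ≤ K) :
    K * Subalgebra.toSubmodule (Algebra.adjoin R (K : Set A)) =
      Subalgebra.toSubmodule (Algebra.adjoin R (K : Set A)) := by
  apply le_antisymm
  · rw [Submodule.mul_le]
    exact fun x hx y hy =>
      (Algebra.adjoin R (K : Set A)).mul_mem (Algebra.subset_adjoin hx) hy
  · calc _ = 1 * Subalgebra.toSubmodule (Algebra.adjoin R (K : Set A)) := (one_mul _).symm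
      _ ≤ _ := mul_le_mul' h1 le_rfl

/-- If the powers of `K ∋ 1` and of `v K` are stationary, then `v` is a unit of `R[K]`. -/
theorem units_smul_adjoin {K : Submodule R A} {v : Aˣ} (h1 : 1 ≤ K)
    (hK : ∃ r, K ^ (r + 1) = K ^ r) (hK' : ∃ r, (v • K) ^ (r + 1) = (v • K) ^ r) :
    v • Subalgebra.toSubmodule (Algebra.adjoin R (K : Set A)) =
      Subalgebra.toSubmodule (Algebra.adjoin R (K : Set A)) := by
  obtain ⟨r, hr⟩ := hK
  obtain ⟨s, hs⟩ := hK'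
  rw [adjoin_eq_pow h1 hr]
  -- At exponent `r + s` both sequences are stationary, so `v^(r+s+1) S = v^(r+s) S`, and the power
  -- of `v` cancels.
  have h2 : (v • K) ^ (r + s + 1) = (v • K) ^ (r + s) := by
    rw [pow_eq_pow_of_stable hs (by omega), ← pow_eq_pow_of_stable hs (Nat.le_add_left s r)]
  rw [units_smul_pow, units_smul_pow, pow_eq_pow_of_stable hr (by omega : r ≤ r + s + 1),
    pow_eq_pow_of_stable hr (by omega : r ≤ r + s), pow_succ, mul_smul] at h2
  exact smul_left_cancel _ h2

theorem units_pow_smul_eq_of_smul_eq {N : Submodule R A} {v : Aˣ} (h : v • N = N) (n : ℕ) :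
    v ^ n • N = N := by
  induction n with
  | zero => simp
  | succ n ih => rw [pow_succ, mul_smul, h, ih]

theorem adjoin_units_smul {K : Submodule R A} {v : Aˣ} (h1 : 1 ≤ K) (h1' : 1 ≤ v • K)
    (hK : ∃ r, K ^ (r + 1) = K ^ r) (hK' : ∃ r, (v • K) ^ (r + 1) = (v • K) ^ r) :
    Algebra.adjoin R ((v • K : Submodule R A) : Set A) = Algebra.adjoin R (K : Set A) := by
  apply Subalgebra.toSubmodule_injective
  have h := units_smul_adjoin h1 hK hK'
  obtain ⟨r, hr⟩ := hK
  obtain ⟨s, hs⟩ := hK'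
  rw [adjoin_eq_pow h1' hs, ← pow_eq_pow_of_stable hs (Nat.le_add_left s r), units_smul_pow,
    pow_eq_pow_of_stable hr (Nat.le_add_right r s), ← adjoin_eq_pow h1 hr,
    units_pow_smul_eq_of_smul_eq h]

theorem stable_units_smul_iff {K : Submodule R A} {v : Aˣ} (h1 : 1 ≤ K) (h1' : 1 ≤ v • K)
    (hK : ∃ r, K ^ (r + 1) = K ^ r) (hK' : ∃ r, (v • K) ^ (r + 1) = (v • K) ^ r) (n : ℕ) :
    (v • K) ^ (n + 1) = (v • K) ^ n ↔ K ^ (n + 1) = K ^ n := by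
  rw [stable_iff_eq_adjoin h1, stable_iff_eq_adjoin h1', adjoin_units_smul h1 h1' hK hK',
    units_smul_pow, ← units_pow_smul_eq_of_smul_eq (units_smul_adjoin h1 hK hK') n,
    smul_left_cancel_iff, units_pow_smul_eq_of_smul_eq (units_smul_adjoin h1 hK hK') n]

end Blowup

/-! ### Parameter ideals, reductions and canonical ideals inside `FractionRing R` -/

section Parameter

open scoped Pointwise
open IsLocalization (coeSubmodule)

variable {R : Type u} [CommRing R]

theorem relativeLength_coeSubmodule_one (A : Type u) [CommRing A] [Algebra R A]
    (hA : Function.Injective (algebraMap R A)) (J : Ideal R) :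
    relativeLength (coeSubmodule A J) 1 = Module.length R (R ⧸ J) := by
  rw [← relativeLength_top, ← IsLocalization.coeSubmodule_top]
  exact relativeLength_map J ⊤ (Algebra.linearMap R A) hA

theorem coeSubmodule_pow (A : Type u) [CommRing A] [Algebra R A] (J : Ideal R) (n : ℕ) :
    coeSubmodule A (J ^ n) = coeSubmodule A J ^ n := by
  induction n with
  | zero => rw [pow_zero, pow_zero, Ideal.one_eq_top, IsLocalization.coeSubmodule_top]
  | succ n ih => rw [pow_succ, IsLocalization.coeSubmodule_mul, ih, pow_succ]

theorem coeSubmodule_span_singleton_mul {A : Type u} [CommRing A] [Algebra R A] {a : R} {u : Aˣ}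
    (hu : algebraMap R A a = u) (J : Ideal R) :
    coeSubmodule A (Ideal.span {a} * J) = u • coeSubmodule A J := by
  rw [IsLocalization.coeSubmodule_mul, IsLocalization.coeSubmodule_span_singleton, hu,
    ← units_smul_one_eq_span, units_smul_mul, one_mul]

theorem fractionalIdeal_eq (I : Ideal R) {a : R} {u : (FractionRing R)ˣ}
    (hu : algebraMap R (FractionRing R) a = u) :
    fractionalIdeal I a = u⁻¹ • coeSubmodule (FractionRing R) I := by
  ext y
  rw [mem_units_smul_iff, inv_inv, ← hu]
  rfl

/-- Division by `u^(n+1)` inside the total ring of fractions. -/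
theorem isReduction_stable_iff (I : Ideal R) {a : R} {u : (FractionRing R)ˣ}
    (hu : algebraMap R (FractionRing R) a = u) (n : ℕ) :
    I ^ (n + 1) = Ideal.span {a} * I ^ n ↔
      fractionalIdeal I a ^ (n + 1) = fractionalIdeal I a ^ n := by
  rw [fractionalIdeal_eq I hu, units_smul_pow, units_smul_pow,
    ← (IsFractionRing.coeSubmodule_injective R (FractionRing R)).eq_iff,
    coeSubmodule_span_singleton_mul hu, coeSubmodule_pow, coeSubmodule_pow,
    ← smul_left_cancel_iff (u⁻¹ ^ (n + 1)), smul_smul, pow_succ u⁻¹, mul_assoc, inv_mul_cancel,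
    mul_one]

theorem one_le_fractionalIdeal {I : Ideal R} {a : R} (ha : a ∈ I) : 1 ≤ fractionalIdeal I a := by
  rw [Submodule.one_le]
  exact ⟨a, ha, by simp⟩

theorem IsReduction.mem {I : Ideal R} {a : R} (h : IsReduction (Ideal.span {a}) I) : a ∈ I :=
  h.1 (Ideal.mem_span_singleton_self a)

theorem IsReduction.exists_stable {I : Ideal R} {a : R} {u : (FractionRing R)ˣ}
    (hu : algebraMap R (FractionRing R) a = u) (h : IsReduction (Ideal.span {a}) I) :
    ∃ n, fractionalIdeal I a ^ (n + 1) = fractionalIdeal I a ^ n :=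
  h.2.imp fun n hn => (isReduction_stable_iff I hu n).1 hn

theorem toSubmodule_fractionalAlgebra_eq {I : Ideal R} {a : R} (haI : a ∈ I) {r : ℕ}
    (hr : fractionalIdeal I a ^ (r + 1) = fractionalIdeal I a ^ r) :
    Subalgebra.toSubmodule (fractionalAlgebra I a) = fractionalIdeal I a ^ r := by
  have h1 := one_le_fractionalIdeal haI
  have h2 := adjoin_eq_pow h1 hr
  rw [← h2, fractionalAlgebra]

theorem fractionalIdeal_le_fractionalAlgebra (I : Ideal R) (a : R) :
    fractionalIdeal I a ≤ Subalgebra.toSubmodule (fractionalAlgebra I a) :=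
  Algebra.subset_adjoin

variable [IsLocalRing R]

theorem IsParameterIdeal.mem_maximalIdeal {a : R} (ha : IsParameterIdeal (Ideal.span {a})) :
    a ∈ IsLocalRing.maximalIdeal R :=
  ha.2 ▸ Ideal.le_radical (Ideal.mem_span_singleton_self a)

/-- The maximal ideal contains a regular element `r`, and some power of `r` is a multiple of `a`; a
factor of a non-zero-divisor is one. -/
theorem IsParameterIdeal.mem_nonZeroDivisors (hCM : IsCohenMacaulayLocalRing R)
    (hdim : ringKrullDim R = 1) {a : R} (ha : IsParameterIdeal (Ideal.span {a})) :
    a ∈ nonZeroDivisors R := by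
  obtain ⟨rs, hmem, hreg, hlen⟩ := hCM.exists_regular
  rw [hdim] at hlen
  have hlen' : rs.length = 1 := by exact_mod_cast hlen
  obtain ⟨r, rfl⟩ := List.length_eq_one_iff.1 hlen'
  have h1 : r ∈ (Ideal.span {a}).radical := ha.2 ▸ hmem r (by simp)
  obtain ⟨n, hn⟩ := h1
  obtain ⟨c, hc⟩ := Ideal.mem_span_singleton'.1 hn
  have h2 : IsSMulRegular R r :=
    (RingTheory.Sequence.isWeaklyRegular_singleton_iff R r).1 hreg.toIsWeaklyRegular
  have h3 : r ∈ nonZeroDivisors R := by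
    rw [mem_nonZeroDivisors_iff_right]
    intro x hx
    refine h2 ?_
    simpa [mul_comm] using hx
  have h4 : c * a ∈ nonZeroDivisors R := hc ▸ pow_mem h3 n
  exact (mul_mem_nonZeroDivisors.1 h4).2

theorem IsParameterIdeal.exists_pow_le [IsNoetherianRing R] {a : R}
    (ha : IsParameterIdeal (Ideal.span {a})) :
    ∃ j, IsLocalRing.maximalIdeal R ^ j ≤ Ideal.span {a} :=
  ha.2 ▸ Ideal.exists_radical_pow_le_of_fg _ (IsNoetherian.noetherian _)

/-- The quotient is a Noetherian local ring with nilpotent maximal ideal, hence Artinian. -/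
theorem IsParameterIdeal.length_quotient_ne_top [IsNoetherianRing R] {a : R}
    (ha : IsParameterIdeal (Ideal.span {a})) :
    Module.length R (R ⧸ Ideal.span {a}) ≠ ⊤ := by
  have hne : Ideal.span {a} ≠ ⊤ := fun h => (IsLocalRing.maximalIdeal.isMaximal R).ne_top
    (by rw [← ha.2, h, Ideal.radical_top])
  have : Nontrivial (R ⧸ Ideal.span {a}) := Ideal.Quotient.nontrivial_iff.2 hne
  have : IsLocalRing (R ⧸ Ideal.span {a}) :=
    IsLocalRing.of_surjective' _ Ideal.Quotient.mk_surjective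
  obtain ⟨j, hj⟩ := ha.exists_pow_le
  have hart : IsArtinianRing (R ⧸ Ideal.span {a}) := by
    rw [isArtinianRing_iff_isNilpotent_maximalIdeal]
    refine ⟨j, ?_⟩
    have h1 : IsLocalRing.maximalIdeal (R ⧸ Ideal.span {a}) ≤
        (IsLocalRing.maximalIdeal R).map (Ideal.Quotient.mk (Ideal.span {a})) := by
      intro x hx
      obtain ⟨x, rfl⟩ := Ideal.Quotient.mk_surjective x
      refine Ideal.mem_map_of_mem _ ?_
      rw [IsLocalRing.mem_maximalIdeal, mem_nonunits_iff] at hx ⊢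
      exact fun h => hx (h.map _)
    rw [Ideal.zero_eq_bot, eq_bot_iff]
    refine (Ideal.pow_right_mono h1 j).trans ?_
    rw [← Ideal.map_pow, Ideal.map_le_iff_le_comap]
    intro x hx
    exact Ideal.Quotient.eq_zero_iff_mem.2 (hj hx)
  rw [Module.length_eq_of_surjective (S := R) (R := R ⧸ Ideal.span {a})
    (M := R ⧸ Ideal.span {a}) Ideal.Quotient.mk_surjective]
  exact Module.length_ne_top

theorem IsCanonicalIdeal.relativeLength_le_one (hdim : ringKrullDim R = 1)
    {I : Ideal R} (hI : IsCanonicalIdeal I) {a : R} {u : (FractionRing R)ˣ}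
    (hu : algebraMap R (FractionRing R) a = u) (ha : a ∈ IsLocalRing.maximalIdeal R) :
    relativeLength (coeSubmodule (FractionRing R) I)
      (coeSubmodule (FractionRing R) I / maximalIdealIn R (FractionRing R)) ≤ 1 := by
  rw [← hI.2.length_ext_eq_one 1 (by rw [hdim]; rfl)]
  exact relativeLength_div_maximalIdealIn_le _
    (Submodule.equivMapOfInjective (Algebra.linearMap R (FractionRing R))
      (IsFractionRing.injective R (FractionRing R)) I).symm ha (hu ▸ u.isUnit)

/-- The parameter `b` of `J` may differ from `a`: a power of `a` lies in `(b)`. This puts two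
canonical ideals among the lattices for one and the same `u`. -/
theorem IsParameterIdeal.isLatticeFor [IsNoetherianRing R] {a : R}
    {u : (FractionRing R)ˣ} (hu : algebraMap R (FractionRing R) a = u)
    (ha : a ∈ IsLocalRing.maximalIdeal R) {J : Ideal R} {b : R}
    (hb : IsParameterIdeal (Ideal.span {b})) (hbJ : b ∈ J) :
    IsLatticeFor u (coeSubmodule (FractionRing R) J) := by
  obtain ⟨n, hn⟩ : a ∈ (Ideal.span {b}).radical := hb.2 ▸ ha
  have haJ : a ^ n ∈ J := (Ideal.span_singleton_le_iff_mem _).2 hbJ hn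
  refine ⟨n, ?_, ?_⟩
  · rw [units_smul_one_eq_span, Submodule.span_singleton_le_iff_mem]
    exact ⟨a ^ n, haJ, by simp [hu]⟩
  · refine (IsIntegralUnit.smul_le (IsIntegralUnit.pow ⟨a, hu⟩ n) _).trans ?_
    rw [← IsLocalization.coeSubmodule_top]
    exact IsLocalization.coeSubmodule_mono _ le_top

end Parameter

/-! ### Hilbert coefficients, conductor and independence -/

section Main

open scoped Pointwise
open IsLocalization (coeSubmodule)

variable {R : Type u} [CommRing R] [IsLocalRing R] [IsNoetherianRing R]

theorem IsParameterIdeal.relativeLength_ne_top {a : R}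
    (ha : IsParameterIdeal (Ideal.span {a})) {u : (FractionRing R)ˣ}
    (hu : algebraMap R (FractionRing R) a = u) :
    relativeLength (u • (1 : Submodule R (FractionRing R))) 1 ≠ ⊤ := by
  rw [← IsLocalization.coeSubmodule_top, ← coeSubmodule_span_singleton_mul hu, Ideal.mul_top,
    IsLocalization.coeSubmodule_top,
    relativeLength_coeSubmodule_one _ (IsFractionRing.injective R (FractionRing R))]
  exact ha.length_quotient_ne_top

theorem IsParameterIdeal.exists_pow_maximalIdeal {a : R}
    (ha : IsParameterIdeal (Ideal.span {a})) {u : (FractionRing R)ˣ}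
    (hu : algebraMap R (FractionRing R) a = u) :
    ∃ j : ℕ, ∀ c ∈ IsLocalRing.maximalIdeal R ^ j, ∃ d : R,
      algebraMap R (FractionRing R) c = algebraMap R (FractionRing R) d * u := by
  obtain ⟨j, hj⟩ := ha.exists_pow_le
  refine ⟨j, fun c hc => ?_⟩
  obtain ⟨d, rfl⟩ := Ideal.mem_span_singleton'.1 (hj hc)
  exact ⟨d, by rw [map_mul, hu]⟩

theorem isLatticeFor_fractionalIdeal {I : Ideal R} {a : R}
    (ha : IsParameterIdeal (Ideal.span {a})) (haI : a ∈ I) {u : (FractionRing R)ˣ}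
    (hu : algebraMap R (FractionRing R) a = u) : IsLatticeFor u (fractionalIdeal I a) := by
  rw [fractionalIdeal_eq I hu]
  simpa using (ha.isLatticeFor hu ha.mem_maximalIdeal haI).inv_pow_smul ⟨a, hu⟩ 1

theorem isLatticeFor_fractionalAlgebra {I : Ideal R} {a : R}
    (ha : IsParameterIdeal (Ideal.span {a})) (haI : IsReduction (Ideal.span {a}) I)
    {u : (FractionRing R)ˣ} (hu : algebraMap R (FractionRing R) a = u) :
    IsLatticeFor u (Subalgebra.toSubmodule (fractionalAlgebra I a)) := by
  obtain ⟨r, hr⟩ := haI.exists_stable hu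
  rw [toSubmodule_fractionalAlgebra_eq haI.mem hr]
  exact (isLatticeFor_fractionalIdeal ha haI.mem hu).pow r

/-- The Hilbert coefficients of `I` are `ℓ(R / a)` and `ℓ(S / R)`. -/
theorem exists_hasHilbertCoefficients {I : Ideal R} {a : R}
    (ha : IsParameterIdeal (Ideal.span {a})) (haI : IsReduction (Ideal.span {a}) I)
    {u : (FractionRing R)ˣ} (hu : algebraMap R (FractionRing R) a = u) :
    ∃ e₀ e₁ : ℤ, HasHilbertCoefficients I e₀ e₁ ∧
      ∃ s l : ℕ,
        relativeLength (fractionalIdeal I a)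
          (Subalgebra.toSubmodule (fractionalAlgebra I a)) = s ∧
        Module.length R (R ⧸ I) = l ∧
        (s : ℤ) = e₁ - (e₀ - (l : ℤ)) := by
  have hui : IsIntegralUnit R u := ⟨a, hu⟩
  have hfin := ha.relativeLength_ne_top hu
  have hinj := IsFractionRing.injective R (FractionRing R)
  have hK := isLatticeFor_fractionalIdeal ha haI.mem hu
  have hS := isLatticeFor_fractionalAlgebra ha haI hu
  have h1K := one_le_fractionalIdeal haI.mem
  have hKS := fractionalIdeal_le_fractionalAlgebra I a
  have hKeq := fractionalIdeal_eq I hu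
  obtain ⟨r, hr⟩ := haI.exists_stable hu
  have hSr := toSubmodule_fractionalAlgebra_eq haI.mem hr
  set K := fractionalIdeal I a
  set S := Subalgebra.toSubmodule (fractionalAlgebra I a)
  have hω : coeSubmodule (FractionRing R) I = u • K := by rw [hKeq, smul_inv_smul]
  obtain ⟨e, he⟩ := ENat.ne_top_iff_exists.1 hfin
  obtain ⟨t, ht⟩ := ENat.ne_top_iff_exists.1
    (IsLatticeFor.relativeLength_ne_top hui hfin isLatticeFor_one hS (h1K.trans hKS))
  obtain ⟨s, hs⟩ := ENat.ne_top_iff_exists.1 (hK.relativeLength_ne_top hui hfin hS hKS)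
  obtain ⟨p, hp⟩ := ENat.ne_top_iff_exists.1
    (IsLatticeFor.relativeLength_ne_top hui hfin isLatticeFor_one hK h1K)
  -- Length count along `u^n R ⊆ u^n S = I^n ⊆ R`, with `e = ℓ(R/aR)` and `t = ℓ(S/R)`.
  have key : ∀ n, r ≤ n → ∃ l : ℕ, Module.length R (R ⧸ I ^ n) = l ∧ n * e = t + l := by
    intro n hn
    have hle : u ^ n • S ≤ 1 := by
      rw [hSr, ← pow_eq_pow_of_stable hr hn, ← units_smul_pow, ← hω, ← coeSubmodule_pow,
        ← IsLocalization.coeSubmodule_top]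
      exact IsLocalization.coeSubmodule_mono _ le_top
    have h1 : Module.length R (R ⧸ I ^ n) = relativeLength (u ^ n • S) 1 := by
      rw [← relativeLength_coeSubmodule_one _ hinj, coeSubmodule_pow, hω, units_smul_pow,
        pow_eq_pow_of_stable hr hn, hSr]
    have h2 := relativeLength_pow_smul hui (1 : Submodule R (FractionRing R)) n
    rw [relativeLength_add (units_smul_le_units_smul_iff.2 (h1K.trans hKS)) hle,
      relativeLength_units_smul, ← ht, ← he, ← h1] at h2
    have h3 : Module.length R (R ⧸ I ^ n) ≠ ⊤ := by
      intro h
      rw [h, add_top] at h2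
      exact WithTop.mul_ne_top (ENat.natCast_ne_top _) (ENat.natCast_ne_top _) h2.symm
    obtain ⟨l, hl⟩ := ENat.ne_top_iff_exists.1 h3
    refine ⟨l, hl.symm, ?_⟩
    rw [← hl] at h2
    exact_mod_cast h2.symm
  have hI : Module.length R (R ⧸ I) = relativeLength (u • K) 1 := by
    rw [← relativeLength_coeSubmodule_one _ hinj, hω]
  have hle : u • K ≤ 1 := by
    rw [← hω, ← IsLocalization.coeSubmodule_top]
    exact IsLocalization.coeSubmodule_mono _ le_top
  have hsplit : (e : ℕ∞) = p + Module.length R (R ⧸ I) := by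
    rw [he, hp, relativeLength_add (units_smul_le_units_smul_iff.2 h1K) hle,
      relativeLength_units_smul, hI]
  have hIfin : Module.length R (R ⧸ I) ≠ ⊤ := fun h => by
    rw [h, add_top] at hsplit
    exact ENat.natCast_ne_top _ hsplit
  obtain ⟨l, hl⟩ := ENat.ne_top_iff_exists.1 hIfin
  have hts : (t : ℕ∞) = p + s := by rw [ht, hp, hs, relativeLength_add h1K hKS]
  rw [← hl] at hsplit
  have hts' : t = p + s := by exact_mod_cast hts
  have hsplit' : e = p + l := by exact_mod_cast hsplit
  refine ⟨e, t, ?_, s, l, hs.symm, hl.symm, by omega⟩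
  filter_upwards [Filter.eventually_ge_atTop r] with n hn
  obtain ⟨k, hk, hk'⟩ := key (n + 1) (hn.trans (Nat.le_succ n))
  refine ⟨k, hk, ?_⟩
  rw [Nat.choose_one_right, mul_comm]
  have : ((n + 1 : ℕ) : ℤ) * e = t + k := by exact_mod_cast hk'
  rw [this]
  ring

theorem relativeLength_eq_length_quotient_conductorIdeal (hdim : ringKrullDim R = 1)
    {I : Ideal R} (hI : IsCanonicalIdeal I) {a : R}
    (ha : IsParameterIdeal (Ideal.span {a})) (haI : IsReduction (Ideal.span {a}) I)
    {u : (FractionRing R)ˣ} (hu : algebraMap R (FractionRing R) a = u) :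
    relativeLength (fractionalIdeal I a) (Subalgebra.toSubmodule (fractionalAlgebra I a)) =
      Module.length R (R ⧸ conductorIdeal (fractionalAlgebra I a)) := by
  have hui : IsIntegralUnit R u := ⟨a, hu⟩
  have hfin := ha.relativeLength_ne_top hu
  have hm := ha.exists_pow_maximalIdeal hu
  have hK := isLatticeFor_fractionalIdeal ha haI.mem hu
  have hS := isLatticeFor_fractionalAlgebra ha haI hu
  have hKS := fractionalIdeal_le_fractionalAlgebra I a
  have htype : relativeLength (fractionalIdeal I a)
      (fractionalIdeal I a / maximalIdealIn R (FractionRing R)) ≤ 1 := by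
    rw [fractionalIdeal_eq I hu, units_smul_div, relativeLength_units_smul]
    exact hI.relativeLength_le_one hdim hu ha.mem_maximalIdeal
  have hmul : fractionalIdeal I a * Subalgebra.toSubmodule (fractionalAlgebra I a) =
      Subalgebra.toSubmodule (fractionalAlgebra I a) :=
    mul_adjoin_eq (one_le_fractionalIdeal haI.mem)
  have hKK := div_self_eq_one hui hm htype hfin hK
  rw [← relativeLength_div_eq hui hm htype hfin hK hK hS hKS, hKK]
  -- `K : S = K : KS = (K : K) : S = R : S`.
  nth_rewrite 1 [← hmul]
  rw [div_mul_eq_div_div_submodule, hKK,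
    ← relativeLength_coeSubmodule_one _ (IsFractionRing.injective R (FractionRing R))]
  congr 1
  -- Restricting `R : S` to `R` loses nothing, because `1 ∈ S`.
  refine (Submodule.map_comap_eq_of_le ?_).symm
  rw [← Submodule.one_eq_range]
  intro x hx
  simpa using Submodule.mem_div_iff_forall_mul_mem.1 hx 1 (one_mem (fractionalAlgebra I a))

theorem fractionalIdeal_independent (hCM : IsCohenMacaulayLocalRing R)
    (hdim : ringKrullDim R = 1) {I J : Ideal R} (hI : IsCanonicalIdeal I)
    (hJ : IsCanonicalIdeal J) {a b : R} (ha : IsParameterIdeal (Ideal.span {a}))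
    (haI : IsReduction (Ideal.span {a}) I) (hb : IsParameterIdeal (Ideal.span {b}))
    (hbJ : IsReduction (Ideal.span {b}) J) :
    reductionNumber (Ideal.span {a}) I = reductionNumber (Ideal.span {b}) J ∧
      relativeLength (fractionalIdeal I a)
          (Subalgebra.toSubmodule (fractionalAlgebra I a)) =
        relativeLength (fractionalIdeal J b)
          (Subalgebra.toSubmodule (fractionalAlgebra J b)) ∧
      relativeLength 1 (fractionalIdeal I a) = relativeLength 1 (fractionalIdeal J b) ∧
      fractionalAlgebra I a = fractionalAlgebra J b := by
  obtain ⟨u, hu⟩ := IsLocalization.map_units (FractionRing R)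
    (⟨a, ha.mem_nonZeroDivisors hCM hdim⟩ : nonZeroDivisors R)
  obtain ⟨w, hw⟩ := IsLocalization.map_units (FractionRing R)
    (⟨b, hb.mem_nonZeroDivisors hCM hdim⟩ : nonZeroDivisors R)
  replace hu := hu.symm
  replace hw := hw.symm
  dsimp only at hu hw
  have hui : IsIntegralUnit R u := ⟨a, hu⟩
  have hfin := ha.relativeLength_ne_top hu
  obtain ⟨v, hv⟩ := exists_units_smul_eq ⟨a, ha.mem_maximalIdeal, hu⟩
    (ha.exists_pow_maximalIdeal hu) hfin
    (hI.relativeLength_le_one hdim hu ha.mem_maximalIdeal)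
    (ha.isLatticeFor hu ha.mem_maximalIdeal haI.mem)
    (hJ.relativeLength_le_one hdim hu ha.mem_maximalIdeal)
    (hb.isLatticeFor hu ha.mem_maximalIdeal hbJ.mem)
  -- `J = vI` in the total ring of fractions, where `I = uK` and `J` is `w` times its own fractional
  -- ideal.
  have hKK : fractionalIdeal J b = (w⁻¹ * v * u) • fractionalIdeal I a := by
    rw [fractionalIdeal_eq J hw, fractionalIdeal_eq I hu, hv, smul_smul, smul_smul, mul_assoc,
      mul_assoc, mul_inv_cancel, mul_one]
  have h1K := one_le_fractionalIdeal haI.mem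
  have h1K' := one_le_fractionalIdeal hbJ.mem
  have hst := haI.exists_stable hu
  have hst' := hbJ.exists_stable hw
  rw [hKK] at h1K' hst'
  have hSS : fractionalAlgebra J b = fractionalAlgebra I a := by
    rw [fractionalAlgebra, hKK, adjoin_units_smul h1K h1K' hst hst', fractionalAlgebra]
  have hlen : relativeLength (fractionalIdeal I a)
        (Subalgebra.toSubmodule (fractionalAlgebra I a)) =
      relativeLength (fractionalIdeal J b)
        (Subalgebra.toSubmodule (fractionalAlgebra J b)) := by
    rw [hSS, hKK]
    -- `S` is rewritten as the same unit times `S`, so that both terms of the quotient are scaled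
    -- alike.
    conv_rhs => rw [fractionalAlgebra, ← units_smul_adjoin h1K hst hst']
    rw [relativeLength_units_smul, fractionalAlgebra]
  refine ⟨?_, hlen, ?_, hSS.symm⟩
  · unfold reductionNumber
    congr 1
    ext n
    rw [Set.mem_ofPred_eq, Set.mem_ofPred_eq, isReduction_stable_iff I hu,
      isReduction_stable_iff J hw, hKK, stable_units_smul_iff h1K h1K' hst hst']
  -- `ℓ(S/R) = ℓ(K/R) + ℓ(S/K)`; `S` and `ℓ(S/K)` are already known to be independent, and `ℓ(S/K)`
  -- is finite.
  · have h1 := relativeLength_add h1K (fractionalIdeal_le_fractionalAlgebra I a)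
    have h2 := relativeLength_add (one_le_fractionalIdeal hbJ.mem)
      (fractionalIdeal_le_fractionalAlgebra J b)
    rw [← hlen, hSS, h1] at h2
    exact WithTop.add_right_cancel (IsLatticeFor.relativeLength_ne_top hui hfin
      (isLatticeFor_fractionalIdeal ha haI.mem hu) (isLatticeFor_fractionalAlgebra ha haI hu)
      (fractionalIdeal_le_fractionalAlgebra I a)) h2

end Main

/-! ### Lengths of localised subquotients -/

section LocalLength

variable {T M : Type u} [CommRing T] [AddCommGroup M] [Module T M] (p : Ideal T) [p.IsPrime]

/-- The length of the localization at a prime `p` of a subquotient `P / N`. -/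
def localizedRelativeLength (N P : Submodule T M) : ℕ∞ :=
  Module.length (Localization.AtPrime p) (LocalizedModule p.primeCompl (SubmoduleQuotient N P))

theorem localizedRelativeLength_add {N P L : Submodule T M} (h : N ≤ P) (h' : P ≤ L) :
    localizedRelativeLength p N L =
      localizedRelativeLength p N P + localizedRelativeLength p P L := by
  let S := p.primeCompl
  let f := IsLocalizedModule.mapExtendScalars S
    (LocalizedModule.mkLinearMap S (SubmoduleQuotient N P))
    (LocalizedModule.mkLinearMap S (SubmoduleQuotient N L)) (Localization.AtPrime p)
    (SubmoduleQuotient.inclusion N h')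
  let g := IsLocalizedModule.mapExtendScalars S
    (LocalizedModule.mkLinearMap S (SubmoduleQuotient N L))
    (LocalizedModule.mkLinearMap S (SubmoduleQuotient P L)) (Localization.AtPrime p)
    (SubmoduleQuotient.proj h L)
  refine Module.length_eq_add_of_exact f g ?_ ?_ ?_
  · exact IsLocalizedModule.map_injective S _ _ _ (SubmoduleQuotient.inclusion_injective N h')
  · exact IsLocalizedModule.map_surjective S _ _ _ (SubmoduleQuotient.proj_surjective h L)
  · exact IsLocalizedModule.map_exact S _ _ _ _ _ (SubmoduleQuotient.exact h h')

theorem localizedRelativeLength_eq_zero {N P : Submodule T M}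
    (h : ∀ x ∈ P, ∃ s ∉ p, s • x ∈ N) : localizedRelativeLength p N P = 0 := by
  refine Module.length_eq_zero_iff.2 (LocalizedModule.subsingleton_iff.2 fun x => ?_)
  obtain ⟨x, rfl⟩ := SubmoduleQuotient.mk_surjective N P x
  obtain ⟨s, hs, hx⟩ := h x x.2
  refine ⟨s, hs, ?_⟩
  rw [← map_smul]
  exact SubmoduleQuotient.mk_eq_zero.2 hx

/-- After localisation the class of `y` generates, is killed by the maximal ideal, and survives: the
module is the residue field at `p`. -/
theorem localizedRelativeLength_eq_one {N P : Submodule T M} {y : M} (hyP : y ∈ P)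
    (hp : ∀ t ∈ p, t • y ∈ N) (hP : ∀ x ∈ P, ∃ s ∉ p, s • x ∈ N ⊔ Submodule.span T {y})
    (hy : ∀ s ∉ p, s • y ∉ N) : localizedRelativeLength p N P = 1 := by
  refine Module.length_eq_one_of_cyclic
    (LocalizedModule.mk (SubmoduleQuotient.mk N P ⟨y, hyP⟩) (1 : p.primeCompl)) ?_ ?_ ?_
  · intro h
    rw [← LocalizedModule.zero_mk (1 : p.primeCompl), LocalizedModule.mk_eq] at h
    obtain ⟨s, hs⟩ := h
    rw [one_smul, one_smul, smul_zero, Submonoid.smul_def, ← map_smul,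
      SubmoduleQuotient.mk_eq_zero] at hs
    exact hy s s.2 hs
  · intro x
    induction x using LocalizedModule.induction_on with
    | h x s =>
      obtain ⟨x, rfl⟩ := SubmoduleQuotient.mk_surjective N P x
      obtain ⟨s', hs', hx⟩ := hP x x.2
      obtain ⟨n, hn, z, hz, hnz⟩ := Submodule.mem_sup.1 hx
      obtain ⟨t, rfl⟩ := Submodule.mem_span_singleton.1 hz
      refine ⟨Localization.mk t (⟨s', hs'⟩ * s), ?_⟩
      rw [LocalizedModule.mk_smul_mk, mul_one, ← LocalizedModule.mk_cancel_common_left ⟨s', hs'⟩ s]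
      congr 1
      rw [Submonoid.smul_def, ← map_smul, ← map_smul, ← sub_eq_zero, ← map_sub,
        SubmoduleQuotient.mk_eq_zero]
      have : s' • (x : M) - t • y = n := by rw [← hnz, add_sub_cancel_right]
      simpa [this] using hn
  · intro c hc
    induction c using Localization.induction_on with
    | H c =>
      obtain ⟨t, s⟩ := c
      have ht : t ∈ p := by
        rw [Localization.mk_eq_mk'] at hc
        exact (IsLocalization.AtPrime.mk'_mem_maximal_iff (Localization.AtPrime p) p t s).1 hc
      rw [LocalizedModule.mk_smul_mk, ← map_smul]
      have : SubmoduleQuotient.mk N P (t • ⟨y, hyP⟩) = 0 :=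
        SubmoduleQuotient.mk_eq_zero.2 (hp t ht)
      rw [this, LocalizedModule.zero_mk]

end LocalLength

/-! ### The Rees algebra `R[at]` as a polynomial ring -/

section ReesAlgebra

variable {R : Type u} [CommRing R]

theorem coeff_comp_C_mul_X_mem (a : R) (g : R[X]) : g.comp (C a * X) ∈
    reesAlgebra (Ideal.span {a}) := by
  intro i
  rw [comp_C_mul_X_coeff, Ideal.span_singleton_pow, mul_comm]
  exact Ideal.mem_span_singleton'.2 ⟨_, mul_comm _ _⟩

/-- The map `R[X] → R[at]`, `X ↦ at`. -/
def polynomialToRees (a : R) : R[X] →+* reesAlgebra (Ideal.span {a}) :=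
  (compRingHom (C a * X)).codRestrict (reesAlgebra (Ideal.span {a}))
    (coeff_comp_C_mul_X_mem a)

theorem coeff_polynomialToRees (a : R) (g : R[X]) (i : ℕ) :
    (polynomialToRees a g : R[X]).coeff i = g.coeff i * a ^ i :=
  comp_C_mul_X_coeff

theorem polynomialToRees_bijective {a : R} (ha : a ∈ nonZeroDivisors R) :
    Function.Bijective (polynomialToRees a) := by
  constructor
  · rw [injective_iff_map_eq_zero]
    intro g hg
    ext i
    have h1 : (polynomialToRees a g : R[X]).coeff i = 0 := by rw [hg]; rfl
    rw [coeff_polynomialToRees] at h1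
    exact (mem_nonZeroDivisors_iff_right.1 (pow_mem ha i)) _ h1
  · rintro ⟨f, hf⟩
    have hc : ∀ i, ∃ c, c * a ^ i = f.coeff i := fun i => by
      have := hf i
      rw [Ideal.span_singleton_pow] at this
      exact Ideal.mem_span_singleton'.1 this
    choose c hc using hc
    refine ⟨∑ i ∈ f.support, monomial i (c i), Subtype.ext ?_⟩
    ext i
    rw [coeff_polynomialToRees, finsetSum_coeff]
    simp only [coeff_monomial, Finset.sum_ite_eq']
    split_ifs with h
    · exact hc i
    · rw [zero_mul, notMem_support_iff.1 h]

/-- For a non-zero-divisor `a`, the Rees algebra `R[at]` is a polynomial ring. -/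
def polynomialEquivRees {a : R} (ha : a ∈ nonZeroDivisors R) :
    R[X] ≃+* reesAlgebra (Ideal.span {a}) :=
  RingEquiv.ofBijective (polynomialToRees a) (polynomialToRees_bijective ha)

theorem polynomialToRees_C (a r : R) :
    polynomialToRees a (C r) = algebraMap R (reesAlgebra (Ideal.span {a})) r :=
  Subtype.ext (C_comp (p := C a * X))

variable [IsLocalRing R]

/-- Transports `𝔪𝓣` to `𝔪R[X]`, which gives both primality and a coefficientwise membership test. -/
theorem maximalIdealMulRees_eq {a : R} (ha : a ∈ nonZeroDivisors R) :
    maximalIdealMulRees (Ideal.span {a}) =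
      ((IsLocalRing.maximalIdeal R).map (C : R →+* R[X])).map (polynomialEquivRees ha) := by
  have h : algebraMap R (reesAlgebra (Ideal.span {a})) =
      ((polynomialEquivRees ha : R[X] ≃+* _) : R[X] →+* _).comp C :=
    RingHom.ext fun r => (polynomialToRees_C a r).symm
  rw [maximalIdealMulRees, h, ← Ideal.map_map]
  rfl

theorem maximalIdealMulRees_isPrime {a : R} (ha : a ∈ nonZeroDivisors R) :
    (maximalIdealMulRees (Ideal.span {a})).IsPrime := by
  rw [maximalIdealMulRees_eq ha]
  infer_instance

theorem polynomialToRees_mem_iff {a : R} (ha : a ∈ nonZeroDivisors R) (g : R[X]) :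
    polynomialToRees a g ∈ maximalIdealMulRees (Ideal.span {a}) ↔
      ∀ n, g.coeff n ∈ IsLocalRing.maximalIdeal R := by
  rw [maximalIdealMulRees_eq ha, Ideal.mem_map_of_equiv, ← Ideal.mem_map_C_iff]
  constructor
  · rintro ⟨x, hx, h⟩
    rwa [← (polynomialToRees_bijective ha).1 h]
  · exact fun h => ⟨g, h, rfl⟩

end ReesAlgebra

/-! ### From lattices to graded modules over `R[at]` -/

section SallyRank

open scoped Pointwise
open IsLocalization (coeSubmodule)

variable {R A : Type u} [CommRing R] [CommRing A] [Algebra R A]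

theorem algebraMap_mem_units_smul_mul {u : Aˣ} {N : Submodule R A} {x : A} {n : ℕ} (c : R) (i : ℕ)
    (hx : x ∈ u ^ n • N) : algebraMap R A c * (u : A) ^ i * x ∈ u ^ (i + n) • N := by
  rw [pow_add, mul_smul, mul_assoc, ← Algebra.smul_def, ← Units.val_pow_eq_pow_val]
  exact Submodule.smul_mem _ c (mul_mem_units_smul hx)

/-- The polynomials `∑ f_j t ^ j` over `R` with `f_j ∈ a ^ (j + 1) N`, as a module over
`R[at]`. -/
def scaledPolynomials {a : R} {u : Aˣ} (hu : algebraMap R A a = u) (N : Submodule R A) :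
    Submodule (reesAlgebra (Ideal.span {a})) R[X] where
  carrier := {f | ∀ j, algebraMap R A (f.coeff j) ∈ u ^ (j + 1) • N}
  zero_mem' j := by simp
  add_mem' hf hg j := by
    rw [coeff_add, map_add]
    exact add_mem (hf j) (hg j)
  smul_mem' t f hf j := by
    change algebraMap R A (((t : R[X]) * f).coeff j) ∈ _
    rw [coeff_mul, map_sum]
    refine Submodule.sum_mem _ fun x hx => ?_
    have h1 := t.2 x.1
    rw [Ideal.span_singleton_pow] at h1
    obtain ⟨c, hc⟩ := Ideal.mem_span_singleton'.1 h1
    rw [← hc, map_mul, map_mul, map_pow, hu, ← Finset.HasAntidiagonal.mem_antidiagonal.1 hx, add_assoc]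
    exact algebraMap_mem_units_smul_mul c _ (hf x.2)

variable {a : R} {u : Aˣ} {hu : algebraMap R A a = u}

theorem mem_scaledPolynomials {N : Submodule R A} {f : R[X]} :
    f ∈ scaledPolynomials hu N ↔ ∀ j, algebraMap R A (f.coeff j) ∈ u ^ (j + 1) • N :=
  Iff.rfl

theorem scaledPolynomials_mono {N P : Submodule R A} (h : N ≤ P) :
    scaledPolynomials hu N ≤ scaledPolynomials hu P :=
  fun _ hf j => units_smul_le_units_smul_iff.2 h (hf j)

theorem monomial_mem_scaledPolynomials {N : Submodule R A} {n : ℕ} {d : R} :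
    monomial n d ∈ scaledPolynomials hu N ↔ algebraMap R A d ∈ u ^ (n + 1) • N := by
  rw [mem_scaledPolynomials]
  constructor
  · intro h
    simpa using h n
  · intro h j
    rw [coeff_monomial]
    split_ifs with hj
    · rwa [← hj]
    · simp

theorem polynomialToRees_monomial_smul (a : R) (n m : ℕ) (c d : R) :
    polynomialToRees a (monomial n c) • (monomial m d : R[X]) =
      monomial (n + m) (c * a ^ n * d) := by
  have h : (polynomialToRees a (monomial n c) : R[X]) = monomial n (c * a ^ n) := by
    ext i
    rw [coeff_polynomialToRees, coeff_monomial, coeff_monomial]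
    split_ifs with h
    · rw [h]
    · rw [zero_mul]
  change (polynomialToRees a (monomial n c) : R[X]) * monomial m d = _
  rw [h, monomial_mul_monomial]

theorem smul_mem_of_monomial_smul_mem {T : Submodule (reesAlgebra (Ideal.span {a})) R[X]}
    {f : R[X]} (t : reesAlgebra (Ideal.span {a})) (h : ∀ j, t • monomial j (f.coeff j) ∈ T) :
    t • f ∈ T := by
  rw [f.as_sum_support, Finset.smul_sum]
  exact Submodule.sum_mem _ fun j _ => h j

theorem coeff_polynomialToRees_smul_monomial (a : R) (g : R[X]) (n i : ℕ) (d : R) :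
    (polynomialToRees a g • (monomial n d : R[X])).coeff (i + n) = g.coeff i * a ^ i * d := by
  change ((polynomialToRees a g : R[X]) * monomial n d).coeff (i + n) = _
  rw [coeff_mul_monomial, coeff_polynomialToRees]

theorem coeff_polynomialToRees_smul_monomial_of_lt (a : R) (g : R[X]) {n k : ℕ} (h : k < n)
    (d : R) : (polynomialToRees a g • (monomial n d : R[X])).coeff k = 0 := by
  change ((polynomialToRees a g : R[X]) * monomial n d).coeff k = _
  rw [← C_mul_X_pow_eq_monomial, ← mul_assoc, coeff_mul_X_pow', if_neg (by omega)]

theorem exists_algebraMap_eq_of_isLatticeFor (hu : algebraMap R A a = u) {N : Submodule R A}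
    (hN : IsLatticeFor u N) {y : A} (hy : y ∈ N) :
    ∃ (n : ℕ) (d : R), algebraMap R A d = (u : A) ^ (n + 1) * y := by
  obtain ⟨n, -, hn⟩ := hN
  obtain ⟨d, hd⟩ := Submodule.mem_one.1 (hn (mul_mem_units_smul hy))
  -- The extra factor `a` matches the exponent `n + 1` required in degree `n` of
  -- `scaledPolynomials`.
  refine ⟨n, a * d, ?_⟩
  rw [map_mul, hu, hd]
  push_cast
  ring

variable [IsLocalRing R]

theorem monomial_notMem_maximalIdealMulRees (ha : a ∈ nonZeroDivisors R) (n : ℕ) :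
    polynomialToRees a (monomial n 1) ∉ maximalIdealMulRees (Ideal.span {a}) := by
  rw [polynomialToRees_mem_iff ha]
  intro h
  have := h n
  rw [coeff_monomial_same] at this
  exact (IsLocalRing.maximalIdeal.isMaximal R).ne_top ((Ideal.eq_top_iff_one _).2 this)

variable (hA : Function.Injective (algebraMap R A)) (ha : a ∈ nonZeroDivisors R)
  [(maximalIdealMulRees (Ideal.span {a})).IsPrime]

include ha in
-- The generator is the monomial `u^(n+1) y t^n`. Multiplying it by `g(at)` gives `u^(i+n+1) g_i y`
-- in degree `i + n`, which lies in `u^(i+n+1) G` exactly when `g_i y ∈ G`, that is, when `g_i ∈ 𝔪`.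
-- So the annihilator of its class is `𝔭`.
theorem localizedRelativeLength_socle_step {G : Submodule R A} {y : A} (hyG : y ∉ G)
    (hy : ∀ c ∈ IsLocalRing.maximalIdeal R, c • y ∈ G)
    (hlat : IsLatticeFor u (G ⊔ Submodule.span R {y})) :
    localizedRelativeLength (maximalIdealMulRees (Ideal.span {a})) (scaledPolynomials hu G)
      (scaledPolynomials hu (G ⊔ Submodule.span R {y})) = 1 := by
  have hyP : y ∈ G ⊔ Submodule.span R {y} :=
    Submodule.mem_sup_right (Submodule.mem_span_singleton_self y)
  obtain ⟨n, d, hd⟩ := exists_algebraMap_eq_of_isLatticeFor hu hlat hyP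
  have hcoeff : ∀ (c : R) (i : ℕ),
      algebraMap R A (c * a ^ i * d) ∈ u ^ (i + n + 1) • G ↔ c • y ∈ G := by
    intro c i
    rw [← mul_mem_units_smul_iff (u := u ^ (i + n + 1)) (x := c • y), map_mul, map_mul, map_pow,
      hu, hd, Algebra.smul_def]
    push_cast
    ring_nf
  refine localizedRelativeLength_eq_one _ (y := monomial n d) ?_ ?_ ?_ ?_
  · rw [monomial_mem_scaledPolynomials, hd, ← Units.val_pow_eq_pow_val]
    exact mul_mem_units_smul hyP
  · intro t ht
    obtain ⟨g, rfl⟩ := (polynomialToRees_bijective ha).2 t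
    rw [polynomialToRees_mem_iff ha] at ht
    intro k
    obtain hk | hk := lt_or_ge k n
    · rw [coeff_polynomialToRees_smul_monomial_of_lt a g hk, map_zero]
      exact zero_mem _
    · obtain ⟨i, rfl⟩ := Nat.exists_eq_add_of_le' hk
      rw [coeff_polynomialToRees_smul_monomial, hcoeff]
      exact hy _ (ht i)
  -- Write `f_j = u^(j+1) (z + cy)` with `z ∈ G`. Then `(at)^n f_j t^j` is `u^(n+j+1) z t^(n+j)`
  -- plus `c (at)^j` times the generator, and `(at)^n ∉ 𝔭`.
  · intro f hf
    refine ⟨_, monomial_notMem_maximalIdealMulRees ha n, smul_mem_of_monomial_smul_mem _ ?_⟩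
    intro j
    obtain ⟨z, hz, w, hw, hzw⟩ := Submodule.mem_sup.1 (mem_units_smul_iff.1 (hf j))
    obtain ⟨c, rfl⟩ := Submodule.mem_span_singleton.1 hw
    rw [Units.eq_inv_mul_iff_mul_eq, Algebra.smul_def] at hzw
    rw [polynomialToRees_monomial_smul, one_mul]
    refine Submodule.mem_sup.2 ⟨monomial (n + j) (a ^ n * f.coeff j - c * a ^ j * d), ?_,
      polynomialToRees a (monomial j c) • monomial n d,
      Submodule.smul_mem _ _ (Submodule.mem_span_singleton_self _), ?_⟩
    · rw [monomial_mem_scaledPolynomials]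
      have : algebraMap R A (a ^ n * f.coeff j - c * a ^ j * d) =
          ((u ^ (n + j + 1) : Aˣ) : A) * z := by
        rw [map_sub, map_mul, map_mul, map_mul, map_pow, map_pow, hu, hd, ← hzw]
        push_cast
        ring
      rw [this]
      exact mul_mem_units_smul hz
    · rw [polynomialToRees_monomial_smul, add_comm j n, ← map_add, sub_add_cancel]
  · intro s hs hmem
    obtain ⟨g, rfl⟩ := (polynomialToRees_bijective ha).2 s
    rw [polynomialToRees_mem_iff ha, not_forall] at hs
    obtain ⟨i, hi⟩ := hs
    have h1 := hmem (i + n)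
    rw [coeff_polynomialToRees_smul_monomial, hcoeff] at h1
    obtain ⟨v, hv⟩ := IsLocalRing.notMem_maximalIdeal.1 hi
    have h2 := G.smul_mem ((v⁻¹ : Rˣ) : R) h1
    rw [← hv, smul_smul, Units.inv_mul, one_smul] at h2
    exact hyG h2

include ha in
theorem localizedRelativeLength_scaledPolynomials
    (hm : ∃ j : ℕ, ∀ c ∈ IsLocalRing.maximalIdeal R ^ j, ∃ d : R, algebraMap R A c =
      algebraMap R A d * u)
    (hfin : relativeLength (u • (1 : Submodule R A)) 1 ≠ ⊤) {G F : Submodule R A}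
    (hG : IsLatticeFor u G) (hF : IsLatticeFor u F) (h : G ≤ F) :
    localizedRelativeLength (maximalIdealMulRees (Ideal.span {a})) (scaledPolynomials hu G)
      (scaledPolynomials hu F) = relativeLength G F := by
  refine IsLatticeFor.induction_socle ⟨a, hu⟩ hm hfin (motive := fun G F =>
    localizedRelativeLength (maximalIdealMulRees (Ideal.span {a})) (scaledPolynomials hu G)
      (scaledPolynomials hu F) = relativeLength G F) ?_ ?_ hG hF h
  · intro G _
    have h0 : relativeLength G G = 0 := relativeLength_eq_zero_iff.2 (le_refl G)
    rw [h0]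
    refine localizedRelativeLength_eq_zero _ fun x hx =>
      ⟨polynomialToRees a (monomial 0 1), monomial_notMem_maximalIdealMulRees ha 0, ?_⟩
    exact Submodule.smul_mem _ _ hx
  · intro G F y _ _ hyG hy hle hlat h1 ih
    have hle' : G ≤ G ⊔ Submodule.span R {y} := le_sup_left
    have h2 := localizedRelativeLength_add (maximalIdealMulRees (Ideal.span {a}))
      (scaledPolynomials_mono (hu := hu) hle') (scaledPolynomials_mono (hu := hu) hle)
    have h3 := relativeLength_add hle' hle
    have h4 := localizedRelativeLength_socle_step (hu := hu) ha hyG hy hlat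
    exact h2.trans ((congrArg₂ _ (h4.trans h1.symm) ih).trans h3.symm)

end SallyRank

/-! ### The Sally module between the lattices `K` and `S` -/

section SallyModule

open scoped Pointwise
open IsLocalization (coeSubmodule)

variable {R : Type u} [CommRing R] {I : Ideal R} {a : R} {u : (FractionRing R)ˣ}
  {hu : algebraMap R (FractionRing R) a = u}

theorem units_pow_smul_fractionalIdeal_pow (hu : algebraMap R (FractionRing R) a = u) (n : ℕ) :
    u ^ n • fractionalIdeal I a ^ n = coeSubmodule (FractionRing R) (I ^ n) := by
  rw [fractionalIdeal_eq I hu, ← units_smul_pow, smul_inv_smul, coeSubmodule_pow]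

theorem algebraMap_mem_coeSubmodule_iff {J : Ideal R} {d : R} :
    algebraMap R (FractionRing R) d ∈ coeSubmodule (FractionRing R) J ↔ d ∈ J := by
  constructor
  · rintro ⟨x, hx, h⟩
    rwa [← IsFractionRing.injective R (FractionRing R) h]
  · exact fun h => ⟨d, h, rfl⟩

/-- In degree `j` both sides are `a^j I = a^(j+1) K`. -/
theorem idealMulReesBase_eq :
    idealMulReesBase (Ideal.span {a}) I = scaledPolynomials hu (fractionalIdeal I a) := by
  have h1 : ∀ j, u ^ (j + 1) • fractionalIdeal I a =
      u ^ j • coeSubmodule (FractionRing R) I := by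
    intro j
    rw [fractionalIdeal_eq I hu, pow_succ, mul_smul, smul_inv_smul]
  apply le_antisymm
  · refine Submodule.span_le.2 ?_
    rintro _ ⟨c, hc, rfl⟩
    rw [SetLike.mem_coe, ← monomial_zero_left, monomial_mem_scaledPolynomials, h1, pow_zero,
      one_smul]
    exact algebraMap_mem_coeSubmodule_iff.2 hc
  · intro f hf
    rw [← one_smul (reesAlgebra (Ideal.span {a})) f]
    refine smul_mem_of_monomial_smul_mem _ fun j => ?_
    have h2 := hf j
    rw [h1, mem_units_smul_iff] at h2
    obtain ⟨c, hc, hcf⟩ := h2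
    have h3 : f.coeff j = 1 * a ^ j * c := by
      apply IsFractionRing.injective R (FractionRing R)
      rw [Algebra.linearMap_apply, Units.eq_inv_mul_iff_mul_eq] at hcf
      rw [← hcf, map_mul, map_mul, map_one, one_mul, map_pow, hu, Units.val_pow_eq_pow_val]
    have h4 := polynomialToRees_monomial_smul a j 0 1 c
    rw [← h3, add_zero] at h4
    rw [one_smul, ← h4, monomial_zero_left]
    exact Submodule.smul_mem _ _ (Submodule.subset_span ⟨c, hc, rfl⟩)

/-- In degree `j`, `I^(j+1) = a^(j+1) K^(j+1) ⊆ a^(j+1) S`. -/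
theorem idealMulRees_le (hu : algebraMap R (FractionRing R) a = u) :
    idealMulRees (Ideal.span {a}) I ≤
      scaledPolynomials hu (Subalgebra.toSubmodule (fractionalAlgebra I a)) := by
  refine Submodule.span_le.2 ?_
  rintro _ ⟨c, hc, g, hg, rfl⟩ j
  rw [coeff_C_mul]
  have h1 : c * g.coeff j ∈ I ^ (j + 1) := by
    rw [pow_succ']
    exact Ideal.mul_mem_mul hc (hg j)
  have h2 := algebraMap_mem_coeSubmodule_iff.2 h1
  rw [← units_pow_smul_fractionalIdeal_pow hu] at h2
  exact units_smul_le_units_smul_iff.2 (pow_le_adjoin _ _) h2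

theorem monomial_mem_idealMulRees {Q : Ideal R} {n : ℕ} {d : R} (hd : d ∈ I ^ (n + 1)) :
    monomial n d ∈ idealMulRees Q I := by
  rw [pow_succ'] at hd
  refine Submodule.mul_induction_on hd ?_ ?_
  · intro c hc x hx
    refine Submodule.subset_span ⟨c, hc, monomial n x, reesAlgebra.monomial_mem.2 hx, ?_⟩
    rw [C_mul_monomial]
  · intro x y hx hy
    rw [map_add]
    exact add_mem hx hy

/-- Multiplying by `(at)^r` moves degree `j` to `r + j`, where `a^(r+j+1) S = a^(r+j+1) K^(r+j+1) =
I^(r+j+1)`. -/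
theorem monomial_smul_mem_idealMulRees (haI : a ∈ I) {r : ℕ}
    (hr : fractionalIdeal I a ^ (r + 1) = fractionalIdeal I a ^ r) {f : R[X]}
    (hf : f ∈ scaledPolynomials hu (Subalgebra.toSubmodule (fractionalAlgebra I a))) :
    polynomialToRees a (monomial r 1) • f ∈ idealMulRees (Ideal.span {a}) I := by
  refine smul_mem_of_monomial_smul_mem _ fun j => ?_
  rw [polynomialToRees_monomial_smul]
  refine monomial_mem_idealMulRees (algebraMap_mem_coeSubmodule_iff.1 ?_)
  rw [← units_pow_smul_fractionalIdeal_pow hu, pow_eq_pow_of_stable hr (by omega),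
    ← toSubmodule_fractionalAlgebra_eq haI hr, map_mul, map_mul, map_pow, hu, add_assoc]
  exact algebraMap_mem_units_smul_mul 1 r (hf j)

/-- The rank of the Sally module is `ℓ(S / K)`. -/
theorem sallyRank_eq [IsLocalRing R] [IsNoetherianRing R]
    [(maximalIdealMulRees (Ideal.span {a})).IsPrime]
    (hreg : a ∈ nonZeroDivisors R) (ha : IsParameterIdeal (Ideal.span {a}))
    (haI : IsReduction (Ideal.span {a}) I) (hu : algebraMap R (FractionRing R) a = u) :
    sallyRank (Ideal.span {a}) I =
      relativeLength (fractionalIdeal I a)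
        (Subalgebra.toSubmodule (fractionalAlgebra I a)) := by
  rw [← localizedRelativeLength_scaledPolynomials (hu := hu) hreg
    (ha.exists_pow_maximalIdeal hu) (ha.relativeLength_ne_top hu)
    (isLatticeFor_fractionalIdeal ha haI.mem hu) (isLatticeFor_fractionalAlgebra ha haI hu)
    (fractionalIdeal_le_fractionalAlgebra I a), ← idealMulReesBase_eq,
    localizedRelativeLength_add _ (idealMulReesBase_le (Ideal.span {a}) I) (idealMulRees_le hu)]
  obtain ⟨r, hr⟩ := haI.exists_stable hu
  -- Since `(at)^r ∉ 𝔭`, the quotient of the module attached to `S` by `I𝓡` vanishes at `𝔭`.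
  rw [localizedRelativeLength_eq_zero (P := scaledPolynomials hu _) _ fun f hf =>
    ⟨_, monomial_notMem_maximalIdealMulRees hreg r, monomial_smul_mem_idealMulRees haI.mem hr hf⟩,
    add_zero]
  rfl

end SallyModule

end

theorem theorem2p3 {R : Type u} [CommRing R] [IsLocalRing R]
    (hCM : IsCohenMacaulayLocalRing R) (hdim : ringKrullDim R = 1)
    (I : Ideal R) (hI : IsCanonicalIdeal I)
    (a : R) (ha : IsParameterIdeal (Ideal.span {a})) (haI : IsReduction (Ideal.span {a}) I) :
    -- the Hilbert coefficients, the formula for the length of `S / K`, the rank, the conductor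
    (∃ e₀ e₁ : ℤ, HasHilbertCoefficients I e₀ e₁ ∧
      ∃ s l : ℕ,
        relativeLength (fractionalIdeal I a)
          (Subalgebra.toSubmodule (fractionalAlgebra I a)) = s ∧
        Module.length R (R ⧸ I) = l ∧
        (s : ℤ) = e₁ - (e₀ - (l : ℤ))) ∧
    (∃ _ : (maximalIdealMulRees (Ideal.span {a})).IsPrime,
      sallyRank (Ideal.span {a}) I =
        relativeLength (fractionalIdeal I a)
          (Subalgebra.toSubmodule (fractionalAlgebra I a))) ∧
    relativeLength (fractionalIdeal I a) (Subalgebra.toSubmodule (fractionalAlgebra I a)) =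
      Module.length R (R ⧸ conductorIdeal (fractionalAlgebra I a)) ∧
    relativeLength 1 (fractionalIdeal I a) ≠ ⊤ ∧
    -- independence of the canonical ideal and of the reduction
    (∀ (J : Ideal R) (b : R), IsCanonicalIdeal J → IsParameterIdeal (Ideal.span {b}) →
      IsReduction (Ideal.span {b}) J →
        reductionNumber (Ideal.span {a}) I = reductionNumber (Ideal.span {b}) J ∧
        relativeLength (fractionalIdeal I a)
            (Subalgebra.toSubmodule (fractionalAlgebra I a)) =
          relativeLength (fractionalIdeal J b)
            (Subalgebra.toSubmodule (fractionalAlgebra J b)) ∧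
        relativeLength 1 (fractionalIdeal I a) = relativeLength 1 (fractionalIdeal J b) ∧
        fractionalAlgebra I a = fractionalAlgebra J b) := by
  have : IsNoetherianRing R := hCM.noetherian
  have hreg := ha.mem_nonZeroDivisors hCM hdim
  obtain ⟨u, hu⟩ := IsLocalization.map_units (FractionRing R) (⟨a, hreg⟩ : nonZeroDivisors R)
  replace hu : algebraMap R (FractionRing R) a = u := hu.symm
  have hprime := maximalIdealMulRees_isPrime hreg
  refine ⟨exists_hasHilbertCoefficients ha haI hu, ⟨hprime, sallyRank_eq hreg ha haI hu⟩,
    relativeLength_eq_length_quotient_conductorIdeal hdim hI ha haI hu, ?_, ?_⟩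
  · exact IsLatticeFor.relativeLength_ne_top ⟨a, hu⟩ (ha.relativeLength_ne_top hu)
      isLatticeFor_one (isLatticeFor_fractionalIdeal ha haI.mem hu)
      (one_le_fractionalIdeal haI.mem)
  · intro J b hJ hb hbJ
    exact fractionalIdeal_independent hCM hdim hI hJ ha haI hb hbJ
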